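/- There is an absolute constant $C>0$ such that the following holds. Let $d\in\mathbb{N}$ and let $F$ be a symmetric probability distribution on $\mathbb{R}^d$ (that is, $F\{A\}=F\{-A\}$ for every Borel set $A$) that is concentrated on $\mathbb{Z}^d$ and satisfies $q:=F\{\vec 0\}\in(0,1)$. For $y\ge 0$ put $$\delta(y)=\sum_{\vec x\in\mathbb{Z}^d\setminus\{\vec 0\}}\min\bigl(1,\;y\,\mathrm{e}\,F\{\vec x\}\bigr).$$ Let $I$ be the unit mass at $\vec 0$, let $*$ denote convolution of finite signed measures on $\mathbb{R}^d$, with $M^{*0}=I$, and let $\exp\{M\}=\sum_{j\ge 0}M^{*j}/j!$. For $n\in\mathbb{N}$ put $$D^{*n}=\exp\Bigl\{n(F-I)-\frac{n(F-I)^{*2}}{2}\Bigr\}.$$ Let $d_{TV}(M,V)=\sup_B|M\{B\}-V\{B\}|$, the supremum being over all Borel sets $B\subseteq\mathbb{R}^d$. Then, for every integer $n\ge 1$, $$d_{TV}(F^{*n},D^{*n})\;\le\;\frac{50.2\,\delta^3(nq/6)}{q^{7/2}\,n^2}\left(1+\frac{C}{q^{7/2}\sqrt{n}}\right)+\frac{C(1-q)^{15/2}}{q^{8}\,n^2\sqrt{n}},$$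 where $\delta^3(y)=(\delta(y))^3$. -/

import Mathlib

open MeasureTheory

noncomputable section

namespace SignedCP

/-- Convolution of finite signed measures: the image of the product measure under addition. -/
def conv {E : Type*} [AddCommGroup E] [MeasurableSpace E] (M V : SignedMeasure E) :
    SignedMeasure E :=
  (VectorMeasure.prod M V (ContinuousLinearMap.mul ℝ ℝ)).map (fun p : E × E => p.1 + p.2)

/-- The unit mass at the origin, as a signed measure. -/
def unitMass (E : Type*) [AddCommGroup E] [MeasurableSpace E] : SignedMeasure E :=
  (Measure.dirac (0 : E)).toSignedMeasure

/-- Convolution powers; the zeroth power is the unit mass at the origin. -/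
def convPow {E : Type*} [AddCommGroup E] [MeasurableSpace E] (M : SignedMeasure E) :
    ℕ → SignedMeasure E
  | 0 => unitMass E
  | j + 1 => conv (convPow M j) M

theorem variation_finite {E : Type*} [MeasurableSpace E] (M : SignedMeasure E) :
    IsFiniteMeasure M.variation := by
  rw [← SignedMeasure.totalVariation_eq_variation]
  infer_instance

theorem conv_apply {E : Type*} [AddCommGroup E] [MeasurableSpace E] [MeasurableAdd₂ E]
    (M V : SignedMeasure E) {A : Set E} (hA : MeasurableSet A) :
    conv M V A =
      VectorMeasure.prod M V (ContinuousLinearMap.mul ℝ ℝ) ((fun p : E × E => p.1 + p.2) ⁻¹' A) :=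
  VectorMeasure.map_apply _ measurable_add hA

theorem variation_conv_le {E : Type*} [AddCommGroup E] [MeasurableSpace E] [MeasurableAdd₂ E]
    (M V : SignedMeasure E) :
    (conv M V).variation Set.univ ≤ M.variation Set.univ * V.variation Set.univ := by
  have := variation_finite M
  have := variation_finite V
  refine (VectorMeasure.variation_map_le Set.univ).trans ?_
  rw [Measure.map_apply measurable_add MeasurableSet.univ, Set.preimage_univ]
  refine (VectorMeasure.variation_prod_le Set.univ).trans ?_
  rw [← Set.univ_prod_univ, Measure.smul_apply, Measure.prod_prod]
  have h : ‖ContinuousLinearMap.mul ℝ ℝ‖ₑ = 1 := by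
    rw [← ofReal_norm, ContinuousLinearMap.opNorm_mul]; simp
  simp [h]

theorem variation_convPow_le {E : Type*} [AddCommGroup E] [MeasurableSpace E] [MeasurableAdd₂ E]
    (M : SignedMeasure E) (j : ℕ) :
    (convPow M j).variation Set.univ ≤ M.variation Set.univ ^ j := by
  induction j with
  | zero => simp [convPow, unitMass, Measure.variation_toSignedMeasure]
  | succ j ih =>
    rw [pow_succ]
    exact (variation_conv_le _ _).trans (mul_le_mul_left ih _)

theorem summable_exp_terms {E : Type*} [AddCommGroup E] [MeasurableSpace E] [MeasurableAdd₂ E]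
    (M : SignedMeasure E) {f : ℕ → Set E} (hf : ∀ i, MeasurableSet (f i))
    (hd : Pairwise (Function.onFun Disjoint f)) :
    Summable fun p : ℕ × ℕ => convPow M p.1 (f p.2) / (p.1.factorial : ℝ) := by
  have hfin := fun j => variation_finite (convPow M j)
  have hM := variation_finite M
  have hs : ∀ j, HasSum (fun i => (convPow M j).variation.real (f i))
      ((convPow M j).variation.real (⋃ i, f i)) := by
    intro j
    have h := (convPow M j).variation.toSignedMeasure.m_iUnion hf hd
    simpa [Measure.toSignedMeasure_apply_measurable, hf, MeasurableSet.iUnion hf] using h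
  have hc : ∀ j, HasSum (fun i => (convPow M j).variation.real (f i) / (j.factorial : ℝ))
      ((convPow M j).variation.real (⋃ i, f i) / (j.factorial : ℝ)) :=
    fun j => (hs j).div_const (j.factorial : ℝ)
  have hb : Summable fun p : ℕ × ℕ =>
      (convPow M p.1).variation.real (f p.2) / (p.1.factorial : ℝ) := by
    rw [summable_prod_of_nonneg (fun p => div_nonneg measureReal_nonneg (Nat.cast_nonneg _))]
    refine ⟨fun j => (hc j).summable, ?_⟩
    simp only [fun j => (hc j).tsum_eq]
    refine Summable.of_nonneg_of_le
      (fun j => div_nonneg measureReal_nonneg (Nat.cast_nonneg _)) (fun j => ?_)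
      (Real.summable_pow_div_factorial (M.variation.real Set.univ))
    refine div_le_div_of_nonneg_right ?_ (Nat.cast_nonneg _)
    refine (measureReal_mono (Set.subset_univ _)).trans ?_
    rw [measureReal_def, measureReal_def, ← ENNReal.toReal_pow]
    exact ENNReal.toReal_mono (ENNReal.pow_ne_top (measure_ne_top _ _)) (variation_convPow_le M j)
  refine Summable.of_norm_bounded hb fun p => ?_
  rw [norm_div, Real.norm_natCast]
  exact div_le_div_of_nonneg_right VectorMeasure.norm_measure_le_variation (Nat.cast_nonneg _)

/-- The exponential measure, the sum over `j` of the `j`-th convolution power divided by `j!`. -/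
def expMeasure {E : Type*} [AddCommGroup E] [MeasurableSpace E] [MeasurableAdd₂ E]
    (M : SignedMeasure E) : SignedMeasure E where
  measureOf' A := ∑' j : ℕ, convPow M j A / (j.factorial : ℝ)
  empty' := by simp
  not_measurable' A hA := by simp [hA]
  m_iUnion' f hf hd := by
    have h := summable_exp_terms M hf hd
    have h1 := h.hasSum.prod_fiberwise fun j =>
      ((convPow M j).m_iUnion hf hd).div_const (j.factorial : ℝ)
    have h2 := ((Equiv.prodComm ℕ ℕ).hasSum_iff.mpr h.hasSum).prod_fiberwise
      fun i => (h.prod_symm.prod_factor i).hasSum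
    rw [h1.tsum_eq]
    exact h2

/-- The series defining the exponential measure converges at every measurable set. -/
theorem hasSum_expMeasure {E : Type*} [AddCommGroup E] [MeasurableSpace E] [MeasurableAdd₂ E]
    (M : SignedMeasure E) {A : Set E} (hA : MeasurableSet A) :
    HasSum (fun j : ℕ => convPow M j A / (j.factorial : ℝ)) (expMeasure M A) := by
  have h := summable_exp_terms M (f := fun i => if i = 0 then A else ∅)
    (fun i => by split_ifs <;> simp [hA])
    (fun i j hij => by by_cases hi : i = 0 <;> by_cases hj : j = 0 <;> simp_all [Function.onFun])
  have h0 : Summable fun j : ℕ => convPow M j A / (j.factorial : ℝ) := by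
    simpa using h.prod_symm.prod_factor 0
  exact h0.hasSum

/-- The total variation distance, the supremum of `|M A - V A|` over all measurable sets `A`. -/
def tvDist {E : Type*} [MeasurableSpace E] (M V : SignedMeasure E) : ℝ :=
  ⨆ A : {A : Set E // MeasurableSet A}, |M A.1 - V A.1|

/-- The supremum in the total variation distance is finite. -/
theorem bddAbove_tvDist {E : Type*} [MeasurableSpace E] (M V : SignedMeasure E) :
    BddAbove (Set.range fun A : {A : Set E // MeasurableSet A} => |M A.1 - V A.1|) := by
  have := variation_finite (M - V)
  refine ⟨(M - V).variation.real Set.univ, ?_⟩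
  rintro _ ⟨A, rfl⟩
  have h : ‖(M - V) A.1‖ ≤ _ := VectorMeasure.norm_measure_le_variation
  exact (h.trans (measureReal_mono (Set.subset_univ _)))

/-- The points of `ℝ ^ d` with integer coordinates. -/
def latticePoint {d : ℕ} (x : Fin d → ℤ) : Fin d → ℝ := fun i => (x i : ℝ)

/-- The distribution `F` on `ℝ ^ d` is symmetric and concentrated on `ℤ ^ d`, and its mass at the
origin lies strictly between `0` and `1`. -/
structure IsSymmetricLattice {d : ℕ} (F : Measure (Fin d → ℝ)) [IsProbabilityMeasure F] :
    Prop where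
  symm : F.map (fun x => -x) = F
  lattice : F (Set.range (latticePoint (d := d)))ᶜ = 0
  zero_pos : 0 < F.real {0}
  zero_lt_one : F.real {0} < 1

/-- The sum of `min (1, y e F{x})` over the nonzero lattice points `x`. -/
def delta {d : ℕ} (F : Measure (Fin d → ℝ)) (y : ℝ) : ℝ :=
  ∑' x : {x : Fin d → ℤ // x ≠ 0}, min 1 (y * Real.exp 1 * F.real {latticePoint x.1})

/-- The signed compound Poisson measure `exp {a (F - I) - a (F - I)^{*2} / 2}`, that is `D^{*a}`. -/
def hippPow {d : ℕ} (F : Measure (Fin d → ℝ)) [IsFiniteMeasure F] (a : ℝ) :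
    SignedMeasure (Fin d → ℝ) :=
  expMeasure (a • (F.toSignedMeasure - unitMass (Fin d → ℝ))
    - (a / 2) • convPow (F.toSignedMeasure - unitMass (Fin d → ℝ)) 2)

end SignedCP
end

/-! Discrete signed measures form a commutative Banach algebra under convolution, normed by total
variation. There write F = q + pG with p = 1 - q and ‖G‖ ≤ 1, and put u = F - 1 = p(G - 1), D =
exp(u - u²/2). As u - u²/2 begins the series of log(1 + u), F - D = u³/3 + u⁴K with K bounded
(`exists_one_add_sub_exp_eq`). The difference Fⁿ - Dⁿ telescopes into n terms F^k D^j (F - D) with k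
+ j = n - 1.

On the unit circle both 1 + p(z - 1) and exp(p(z - 1) - p²(z - 1)²/2) have modulus at most exp(-pq(1
- cos t)), which is the modulus of exp(qp(z - 1)). Hence F^k D^j can give up the factor exp((nq/2)u)
= E³, E = exp((nq/6)u), and stay bounded. The main part of each term is then a third of (uE)³ times
the bounded remainder F^k D^j exp(-(nq/2)u). Two estimates carry the proof.

Smoothing (`norm_generator_mul_exp_le`): by symmetry u is a mixture of second differences, each of
which is damped by its own share of the exponential. This gives ‖uE‖ ≤ 12 δ(nq/6) / (e n q).

Remainder (`norm_mixProd_half_le`): the remainder is a power series in G, so its norm is at most the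
sum of the absolute values of the coefficients. Cauchy–Schwarz with a Lorentz weight centred at the
mean, together with Parseval, reduces that sum to Gaussian-type integrals on the circle
(`sq_tsum_abs_le`, `norm_mixProd_sq_le_of_bounds`). The result is 3.5 plus a term of order 1/√(nq³).

The u⁴K part gives up exp((3nq/4)u) instead; the extra quarter turns the fourth u into a gain of
order 1/√(nq). As Fⁿ - Dⁿ has total mass zero, the distance is at most half the norm, and (1/2) · n
· (12/(enq))³ · 3.5/3 = 1008/(e³q³n²) with 1008/e³ < 50.2. The last summand of the asserted bound is
not needed. -/

namespace SignedCP

/-! ### Summing the Lorentz kernel over the integers -/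

/-- The derivative of arctan decreases on the nonnegative axis, so on [y, x] it is at least its
value at x. This is the integral comparison for sums of the Lorentz kernel. -/
theorem sub_div_one_add_sq_le_arctan_sub {x y : ℝ} (hy : 0 ≤ y) (hxy : y ≤ x) :
    (x - y) / (1 + x ^ 2) ≤ Real.arctan x - Real.arctan y := by
  have h := (convex_Icc y x).mul_sub_le_image_sub_of_le_deriv (f := Real.arctan)
    (C := 1 / (1 + x ^ 2)) Real.continuous_arctan.continuousOn
    Real.differentiable_arctan.differentiableOn
    (fun t ht => by
      rw [interior_Icc] at ht
      rw [Real.deriv_arctan]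
      have : 0 ≤ t := hy.trans ht.1.le
      have h2 := ht.2.le
      exact one_div_le_one_div_of_le (by positivity) (by nlinarith))
    y (Set.left_mem_Icc.2 hxy) x (Set.right_mem_Icc.2 hxy) hxy
  calc _ = 1 / (1 + x ^ 2) * (x - y) := by ring
    _ ≤ _ := h

/-- The Lorentz kernel of width `b`. -/
noncomputable def lorentz (b x : ℝ) : ℝ := 1 / (1 + (x / b) ^ 2)

theorem lorentz_nonneg (b x : ℝ) : 0 ≤ lorentz b x := by unfold lorentz; positivity

theorem lorentz_le_one (b x : ℝ) : lorentz b x ≤ 1 := by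
  unfold lorentz
  rw [div_le_one (by positivity)]
  nlinarith [sq_nonneg (x / b)]

theorem lorentz_neg (b x : ℝ) : lorentz b (-x) = lorentz b x := by
  simp [lorentz, neg_div]

theorem mul_lorentz_le {b x h : ℝ} (hb : 0 < b) (hh : 0 ≤ h) (hx : h ≤ x) :
    h * lorentz b x ≤ b * (Real.arctan (x / b) - Real.arctan ((x - h) / b)) := by
  have := sub_div_one_add_sq_le_arctan_sub (x := x / b) (y := (x - h) / b)
    (div_nonneg (by linarith) hb.le) (by gcongr; linarith)
  calc h * lorentz b x = b * ((x / b - (x - h) / b) / (1 + (x / b) ^ 2)) := by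
        unfold lorentz; field_simp; ring
    _ ≤ _ := by gcongr

theorem sum_lorentz_shift_le {b y : ℝ} (hb : 0 < b) (hy : 0 ≤ y) (N : ℕ) :
    ∑ i ∈ Finset.range N, lorentz b (y + (i + 1)) ≤
      b * (Real.pi / 2 - Real.arctan (y / b)) := by
  have h : ∑ i ∈ Finset.range N, lorentz b (y + (i + 1)) ≤
      b * (Real.arctan ((y + N) / b) - Real.arctan (y / b)) := by
    induction N with
    | zero => simp
    | succ N ih =>
      rw [Finset.sum_range_succ]
      have := mul_lorentz_le (b := b) (x := y + (N + 1)) (h := 1) hb zero_le_one (by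
        have : (0 : ℝ) ≤ N := Nat.cast_nonneg _
        linarith)
      have e : y + ((N : ℝ) + 1) - 1 = y + N := by ring
      rw [e] at this
      push_cast
      linarith
  refine h.trans ?_
  have := Real.arctan_lt_pi_div_two ((y + N) / b)
  gcongr

/-- The kernel has integral πb, and comparing the sum with the integral costs at most the maximum 1.
The integers are split at the floor of α; y and y' are the distances to the two neighbours. Beyond
the neighbours the sum is at most b(π/2 - arctan(y/b)) on one side, and likewise with y' on the
other. -/
theorem sum_lorentz_le {b : ℝ} (hb : 0 < b) (α : ℝ) (s : Finset ℤ) :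
    ∑ k ∈ s, lorentz b (k - α) ≤ 1 + Real.pi * b := by
  set m : ℤ := ⌊α⌋ with hm
  obtain ⟨N, hN⟩ : ∃ N : ℕ, ∀ k ∈ s, (k - m).natAbs ≤ N :=
    ⟨s.sup fun k => (k - m).natAbs, fun k hk => Finset.le_sup (f := fun k => (k - m).natAbs) hk⟩
  set y : ℝ := m + 1 - α
  set y' : ℝ := α - m
  have hy : 0 ≤ y := by have := Int.lt_floor_add_one α; simp only [y]; linarith
  have hy' : 0 ≤ y' := by have := Int.floor_le α; simp only [y']; linarith
  have hsub : s ⊆ (Finset.range (N + 1)).image (fun i : ℕ => m + 1 + (i : ℤ)) ∪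
      (Finset.range (N + 1)).image (fun i : ℕ => m - (i : ℤ)) := by
    intro k hk
    have := hN k hk
    simp only [Finset.mem_union, Finset.mem_image, Finset.mem_range]
    rcases le_or_gt k m with h | h
    · exact Or.inr ⟨(m - k).toNat, by omega, by omega⟩
    · exact Or.inl ⟨(k - m - 1).toNat, by omega, by omega⟩
  have h1 : ∑ k ∈ s, lorentz b (k - α) ≤
      ∑ i ∈ Finset.range (N + 1), lorentz b (y + i) +
      ∑ i ∈ Finset.range (N + 1), lorentz b (y' + i) := by
    refine (Finset.sum_le_sum_of_subset_of_nonneg hsub fun _ _ _ => lorentz_nonneg _ _).trans ?_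
    refine (le_add_of_nonneg_right (Finset.sum_nonneg fun _ _ => lorentz_nonneg _ _)).trans
      (Finset.sum_union_inter (f := fun k : ℤ => lorentz b (k - α))).le |>.trans ?_
    rw [Finset.sum_image (by intro a _ b _ h; simpa using h),
      Finset.sum_image (by intro a _ b _ h; simpa using h)]
    refine le_of_eq ?_
    congr 1
    · refine Finset.sum_congr rfl fun i _ => ?_
      congr 1; push_cast; simp only [y]; ring
    · refine Finset.sum_congr rfl fun i _ => ?_
      rw [← lorentz_neg]
      congr 1; push_cast; simp only [y']; ring
  rw [Finset.sum_range_succ', Finset.sum_range_succ'] at h1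
  have h2 := sum_lorentz_shift_le hb hy N
  have h3 := sum_lorentz_shift_le hb hy' N
  have h4 := mul_lorentz_le (b := b) hb hy le_rfl
  have h5 := mul_lorentz_le (b := b) hb hy' le_rfl
  simp only [sub_self, zero_div, Real.arctan_zero, sub_zero] at h4 h5
  push_cast at h1
  simp only [add_zero] at h1
  -- As y + y' = 1 and the kernel is at most 1, the weights 1 - y and 1 - y' add up to a total of at
  -- most 1. The parts weighted by y and y' are absorbed by the arctangents in `h4` and `h5`.
  have h6 : lorentz b y + lorentz b y' ≤ 1 + (y * lorentz b y + y' * lorentz b y') := by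
    have e : y' = 1 - y := by simp only [y, y']; ring
    rw [e] at hy' ⊢
    nlinarith [lorentz_le_one b y, lorentz_le_one b (1 - y), lorentz_nonneg b y,
      lorentz_nonneg b (1 - y)]
  linarith

/-! ### Parseval and the bound for the sum of absolute values of Fourier coefficients -/

theorem sum_sq_eq_circleAverage (c : ℕ → ℝ) (N : ℕ) :
    ∑ k ∈ Finset.range N, c k ^ 2 =
      Real.circleAverage (fun z : ℂ => ‖∑ k ∈ Finset.range N, (c k : ℂ) * z ^ k‖ ^ 2) 0 1 := by
  classical
  set P : Polynomial ℂ := ∑ k ∈ Finset.range N, Polynomial.monomial k (c k : ℂ) with hP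
  have hcoef : ∀ i, P.coeff i = if i ∈ Finset.range N then (c i : ℂ) else 0 := by
    intro i
    rw [hP, Polynomial.finsetSum_coeff]
    simp only [Polynomial.coeff_monomial, Finset.sum_ite_eq']
  have h := Polynomial.sum_sq_norm_coeff_eq_circleAverage P
  have he : (fun z : ℂ => ‖P.eval z‖ ^ 2) =
      (fun z : ℂ => ‖∑ k ∈ Finset.range N, (c k : ℂ) * z ^ k‖ ^ 2) := by
    funext z
    rw [hP, Polynomial.eval_finsetSum]
    simp only [Polynomial.eval_monomial]
  rw [he] at h
  rw [← h]
  symm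
  rw [Finset.sum_subset (s₂ := Finset.range N)]
  · refine Finset.sum_congr rfl fun i hi => ?_
    rw [hcoef, if_pos hi]
    simp
  · intro i hi
    by_contra hn
    rw [Polynomial.mem_support_iff, hcoef, if_neg hn] at hi
    exact hi rfl
  · intro i _ hi
    rw [Polynomial.notMem_support_iff.1 hi]
    simp

/-- Parseval for the truncations passes to the limit by dominated convergence, with (∑|c k|)² as
dominating constant; the partial sums of squares increase to that limit. Only a continuous periodic
majorant of |φ|² on the circle enters the result. -/
theorem sum_sq_le_integral {c : ℕ → ℝ} (hc : Summable fun k => |c k|) {φ : ℂ → ℂ}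
    (hφ : ∀ z : ℂ, ‖z‖ = 1 → HasSum (fun k => (c k : ℂ) * z ^ k) (φ z)) {a : ℝ → ℝ}
    (ha : Continuous a) (hper : Function.Periodic a (2 * Real.pi))
    (hφa : ∀ t : ℝ, ‖φ (Complex.exp (t * Complex.I))‖ ^ 2 ≤ a t) (N : ℕ) :
    ∑ k ∈ Finset.range N, c k ^ 2 ≤
      (2 * Real.pi)⁻¹ * ∫ t in (-Real.pi)..Real.pi, a t := by
  have hz : ∀ t : ℝ, circleMap 0 1 t = Complex.exp (t * Complex.I) := fun t => by simp [circleMap]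
  have hn : ∀ t : ℝ, ‖Complex.exp (t * Complex.I)‖ = 1 := fun t => Complex.norm_exp_ofReal_mul_I t
  set T := ∑' k, |c k| with hT
  have hlim : Filter.Tendsto (fun n => ∑ k ∈ Finset.range n, c k ^ 2) Filter.atTop
      (nhds ((2 * Real.pi)⁻¹ * ∫ t in (0 : ℝ)..(2 * Real.pi),
        ‖φ (Complex.exp (t * Complex.I))‖ ^ 2)) := by
    simp_rw [sum_sq_eq_circleAverage c, Real.circleAverage_def, hz, smul_eq_mul]
    refine Filter.Tendsto.const_mul _ ?_
    refine intervalIntegral.tendsto_integral_filter_of_dominated_convergence (fun _ => T ^ 2)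
      ?_ ?_ ?_ ?_
    · refine Filter.Eventually.of_forall fun n => Continuous.aestronglyMeasurable ?_
      fun_prop
    · refine Filter.Eventually.of_forall fun n => Filter.Eventually.of_forall fun t _ => ?_
      rw [Real.norm_of_nonneg (by positivity)]
      gcongr
      refine (norm_sum_le _ _).trans ?_
      refine le_trans (le_of_eq (Finset.sum_congr rfl fun k _ => ?_))
        (hc.sum_le_tsum (Finset.range n) fun _ _ => abs_nonneg _)
      rw [norm_mul, norm_pow, hn, one_pow, mul_one, Complex.norm_real, Real.norm_eq_abs]
    · exact intervalIntegrable_const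
    · refine Filter.Eventually.of_forall fun t _ => ?_
      exact ((hφ _ (hn t)).tendsto_sum_nat.norm).pow 2
  have hmono : Monotone (fun n => ∑ k ∈ Finset.range n, c k ^ 2) :=
    fun i j hij => Finset.sum_le_sum_of_subset_of_nonneg
      (Finset.range_subset_range.2 hij) fun _ _ _ => sq_nonneg _
  refine (hmono.ge_of_tendsto hlim N).trans ?_
  have hπ := Real.pi_pos
  have e : ∫ t in (-Real.pi)..Real.pi, a t = ∫ t in (0 : ℝ)..(2 * Real.pi), a t := by
    have := hper.intervalIntegral_add_eq (-Real.pi) 0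
    rw [zero_add, show -Real.pi + 2 * Real.pi = Real.pi by ring] at this
    exact this
  rw [e]
  refine mul_le_mul_of_nonneg_left ?_ (by positivity)
  rw [intervalIntegral.integral_of_le (by positivity), intervalIntegral.integral_of_le (by positivity)]
  refine integral_mono_of_nonneg (Filter.Eventually.of_forall fun t => by positivity) ?_
    (Filter.Eventually.of_forall hφa)
  exact (ha.integrableOn_Icc (a := 0) (b := 2 * Real.pi)).mono_set Set.Ioc_subset_Icc_self

/-- Bounding the sum of the absolute values of the coefficients of `φ` by the mean squares of `φ`
and of its centred derivative. -/
theorem sq_tsum_abs_le {c : ℕ → ℝ} (hc : Summable fun k => |c k|)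
    (hc' : Summable fun k : ℕ => |(k : ℝ) * c k|) {φ ψ : ℂ → ℂ}
    (hφ : ∀ z : ℂ, ‖z‖ = 1 → HasSum (fun k => (c k : ℂ) * z ^ k) (φ z))
    (hψ : ∀ z : ℂ, ‖z‖ = 1 → HasSum (fun k : ℕ => (((k : ℝ) * c k : ℝ) : ℂ) * z ^ k) (ψ z))
    (α : ℝ) {b : ℝ} (hb : 0 < b) {a₀ a₁ : ℝ → ℝ} (h₀ : Continuous a₀) (h₁ : Continuous a₁)
    (hper₀ : Function.Periodic a₀ (2 * Real.pi)) (hper₁ : Function.Periodic a₁ (2 * Real.pi))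
    (hφa : ∀ t : ℝ, ‖φ (Complex.exp (t * Complex.I))‖ ^ 2 ≤ a₀ t)
    (hψa : ∀ t : ℝ, ‖ψ (Complex.exp (t * Complex.I)) - α * φ (Complex.exp (t * Complex.I))‖ ^ 2
      ≤ a₁ t) :
    (∑' k, |c k|) ^ 2 ≤ (1 + Real.pi * b) *
      ((2 * Real.pi)⁻¹ * (∫ t in (-Real.pi)..Real.pi, a₀ t) +
        (2 * Real.pi)⁻¹ * (∫ t in (-Real.pi)..Real.pi, a₁ t) / b ^ 2) := by
  have hd : Summable fun k : ℕ => |((k : ℝ) - α) * c k| := by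
    refine Summable.of_nonneg_of_le (fun _ => abs_nonneg _) (fun k => ?_)
      (hc'.add (hc.mul_left |α|))
    rw [sub_mul, ← abs_mul]
    exact abs_sub _ _
  have key : ∀ N : ℕ, (∑ k ∈ Finset.range N, |c k|) ^ 2 ≤ (1 + Real.pi * b) *
      ((2 * Real.pi)⁻¹ * (∫ t in (-Real.pi)..Real.pi, a₀ t) +
        (2 * Real.pi)⁻¹ * (∫ t in (-Real.pi)..Real.pi, a₁ t) / b ^ 2) := by
    intro N
    have hA := sum_sq_le_integral hc hφ h₀ hper₀ hφa N
    have hB := sum_sq_le_integral hd (φ := fun z => ψ z - α * φ z) (fun z hz => by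
      refine ((hψ z hz).sub ((hφ z hz).mul_left (α : ℂ))).congr_fun fun k => ?_
      push_cast; ring) h₁ hper₁ hψa N
    have hL := sum_lorentz_le hb α ((Finset.range N).map ⟨fun k : ℕ => (k : ℤ), Nat.cast_injective⟩)
    rw [Finset.sum_map] at hL
    simp only [Function.Embedding.coeFn_mk, Int.cast_natCast] at hL
    -- Cauchy–Schwarz after multiplying and dividing |c k| by the square root of the Lorentz weight.
    -- The reciprocal weight 1 + ((k - α)/b)² is what Parseval can handle, through φ and the centred
    -- derivative ψ - αφ.
    have hCS := Finset.sum_mul_sq_le_sq_mul_sq (Finset.range N)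
      (fun k => √(lorentz b (k - α))) (fun k => √(1 + (((k : ℝ) - α) / b) ^ 2) * |c k|)
    have e1 : ∀ k : ℕ, √(lorentz b (k - α)) * (√(1 + (((k : ℝ) - α) / b) ^ 2) * |c k|) = |c k| := by
      intro k
      rw [← mul_assoc, ← Real.sqrt_mul (lorentz_nonneg _ _), lorentz,
        one_div_mul_cancel (by positivity), Real.sqrt_one, one_mul]
    have e2 : ∀ k : ℕ, √(lorentz b (k - α)) ^ 2 = lorentz b (k - α) :=
      fun k => Real.sq_sqrt (lorentz_nonneg _ _)
    have e3 : ∀ k : ℕ, (√(1 + (((k : ℝ) - α) / b) ^ 2) * |c k|) ^ 2 =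
        c k ^ 2 + (((k : ℝ) - α) * c k) ^ 2 / b ^ 2 := by
      intro k
      rw [mul_pow, Real.sq_sqrt (by positivity), sq_abs]
      field_simp
    simp only [e1, e2, e3] at hCS
    refine hCS.trans ?_
    rw [Finset.sum_add_distrib, ← Finset.sum_div]
    have h0 : 0 ≤ ∑ k ∈ Finset.range N, c k ^ 2 + (∑ k ∈ Finset.range N, ((↑k - α) * c k) ^ 2) / b ^ 2 := by
      positivity
    have hπ := Real.pi_pos
    refine mul_le_mul hL ?_ h0 (by positivity)
    gcongr
  exact le_of_tendsto' (hc.hasSum.tendsto_sum_nat.pow 2) key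

/-! ### The exponential in a real Banach algebra -/

section Exp

variable {𝔸 : Type*} [NormedCommRing 𝔸] [NormedAlgebra ℝ 𝔸]

theorem exp_add_real [CompleteSpace 𝔸] (x y : 𝔸) :
    NormedSpace.exp (x + y) = NormedSpace.exp x * NormedSpace.exp y := by
  let := NormedAlgebra.restrictScalars ℚ ℝ 𝔸
  exact NormedSpace.exp_add_of_commute (Commute.all x y)

theorem exp_natCast_smul_real [CompleteSpace 𝔸] (n : ℕ) (x : 𝔸) :
    NormedSpace.exp ((n : ℝ) • x) = NormedSpace.exp x ^ n := by
  let := NormedAlgebra.restrictScalars ℚ ℝ 𝔸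
  rw [Nat.cast_smul_eq_nsmul, NormedSpace.exp_nsmul]

theorem exp_smul_one_real (c : ℝ) :
    NormedSpace.exp (c • (1 : 𝔸)) = Real.exp c • (1 : 𝔸) := by
  have h := NormedSpace.algebraMap_exp_comm (𝕂 := ℝ) (𝔸 := 𝔸) c
  rw [Algebra.algebraMap_eq_smul_one, Algebra.algebraMap_eq_smul_one] at h
  rw [← h, Real.exp_eq_exp_ℝ]

theorem norm_exp_le_real [CompleteSpace 𝔸] [NormOneClass 𝔸] (x : 𝔸) : ‖NormedSpace.exp x‖ ≤ Real.exp ‖x‖ := by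
  have h1 := NormedSpace.exp_series_hasSum_exp' (𝕂 := ℝ) x
  have h2 := NormedSpace.exp_series_hasSum_exp' (𝕂 := ℝ) ‖x‖
  rw [← Real.exp_eq_exp_ℝ] at h2
  rw [← h1.tsum_eq, ← h2.tsum_eq]
  refine tsum_of_norm_bounded h2.summable.hasSum fun i => ?_
  rw [norm_smul, smul_eq_mul, Real.norm_of_nonneg (by positivity)]
  gcongr
  exact norm_pow_le _ _

/-- Taylor expansion of order three of the exponential, with a bound for the remainder. -/
theorem exists_exp_eq_taylor [CompleteSpace 𝔸] [NormOneClass 𝔸] (y : 𝔸) :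
    ∃ R : 𝔸, ‖R‖ ≤ Real.exp ‖y‖ ∧
      NormedSpace.exp y = 1 + y + (1 / 2 : ℝ) • y ^ 2 + (1 / 6 : ℝ) • y ^ 3 + y ^ 4 * R := by
  have h1 := NormedSpace.exp_series_hasSum_exp' (𝕂 := ℝ) y
  have h2 := NormedSpace.exp_series_hasSum_exp' (𝕂 := ℝ) ‖y‖
  rw [← Real.exp_eq_exp_ℝ] at h2
  have hb : ∀ i : ℕ, ‖(((i + 4).factorial : ℝ)⁻¹) • y ^ i‖ ≤ ((i.factorial : ℝ)⁻¹) • ‖y‖ ^ i := by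
    intro i
    rw [norm_smul, smul_eq_mul, Real.norm_of_nonneg (by positivity)]
    gcongr
    · omega
    · exact norm_pow_le _ _
  have hs : Summable fun i : ℕ => (((i + 4).factorial : ℝ)⁻¹) • y ^ i :=
    Summable.of_norm_bounded h2.summable hb
  refine ⟨∑' i : ℕ, (((i + 4).factorial : ℝ)⁻¹) • y ^ i, ?_, ?_⟩
  · rw [← h2.tsum_eq]
    exact tsum_of_norm_bounded h2.summable.hasSum hb
  · rw [← h1.tsum_eq, ← h1.summable.sum_add_tsum_nat_add 4, ← hs.tsum_mul_left]
    congr 1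
    · simp [Finset.sum_range_succ, Nat.factorial]
    · refine tsum_congr fun i => ?_
      rw [mul_smul_comm, pow_add, mul_comm]

end Exp

/-! ### Power series evaluated in a Banach algebra and on the unit circle -/

theorem hasSum_antidiagonal {R : Type*} [NormedRing R] [CompleteSpace R] {f g : ℕ → R} {x y : R}
    (hf : Summable fun n => ‖f n‖) (hg : Summable fun n => ‖g n‖) (hx : HasSum f x)
    (hy : HasSum g y) :
    HasSum (fun n => ∑ kl ∈ Finset.HasAntidiagonal.antidiagonal n, f kl.1 * g kl.2) (x * y) := by
  rw [← hx.tsum_eq, ← hy.tsum_eq, tsum_mul_tsum_eq_tsum_sum_antidiagonal_of_summable_norm hf hg]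
  exact (summable_norm_sum_mul_antidiagonal_of_summable_norm hf hg).of_norm.hasSum

/-- The element `x` of the algebra is a power series in `G` with coefficients `c`, while the values
on the unit circle of the same power series and of its derivative times `z` are `φ z` and `ψ z`. -/
structure IsSeries {𝔸 : Type*} [NormedCommRing 𝔸] [NormedAlgebra ℝ 𝔸] (G : 𝔸) (c : ℕ → ℝ)
    (x : 𝔸) (φ ψ : ℂ → ℂ) : Prop where
  summable : Summable fun k => |c k|
  summable_deriv : Summable fun k : ℕ => |(k : ℝ) * c k|
  hasSum : HasSum (fun k => c k • G ^ k) x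
  hasSum_circle : ∀ z : ℂ, ‖z‖ = 1 → HasSum (fun k => (c k : ℂ) * z ^ k) (φ z)
  hasSum_deriv : ∀ z : ℂ, ‖z‖ = 1 →
    HasSum (fun k : ℕ => (((k : ℝ) * c k : ℝ) : ℂ) * z ^ k) (ψ z)

section Series

variable {𝔸 : Type*} [NormedCommRing 𝔸] [NormedAlgebra ℝ 𝔸] {G : 𝔸}

theorem norm_smul_pow_le [NormOneClass 𝔸] (hG : ‖G‖ ≤ 1) (a : ℝ) (k : ℕ) : ‖a • G ^ k‖ ≤ |a| := by
  rw [norm_smul, Real.norm_eq_abs]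
  exact mul_le_of_le_one_right (abs_nonneg _) ((norm_pow_le _ _).trans (pow_le_one₀ (norm_nonneg _) hG))

/-- The passage from the Banach algebra to scalar analysis: from here on only the coefficients
matter, and they are governed by the values on the circle. -/
theorem IsSeries.norm_le [NormOneClass 𝔸] (hG : ‖G‖ ≤ 1) {c : ℕ → ℝ} {x : 𝔸} {φ ψ : ℂ → ℂ}
    (h : IsSeries G c x φ ψ) : ‖x‖ ≤ ∑' k, |c k| := by
  rw [← h.hasSum.tsum_eq]
  exact tsum_of_norm_bounded h.summable.hasSum fun k => norm_smul_pow_le hG _ _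

theorem IsSeries.congr {c : ℕ → ℝ} {x y : 𝔸} {φ ψ χ ω : ℂ → ℂ} (h : IsSeries G c x φ ψ)
    (hx : x = y) (hφ : ∀ z, φ z = χ z) (hψ : ∀ z, ψ z = ω z) : IsSeries G c y χ ω := by
  rwa [← hx, ← funext hφ, ← funext hψ]

/-- The Cauchy product, taken in the algebra and on the circle at once. Since n = k + l on the
antidiagonal, multiplication of coefficients by n obeys the Leibniz rule. -/
theorem IsSeries.mul [NormOneClass 𝔸] [CompleteSpace 𝔸] (hG : ‖G‖ ≤ 1) {c d : ℕ → ℝ} {x y : 𝔸} {φ ψ χ ω : ℂ → ℂ}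
    (h : IsSeries G c x φ ψ) (h' : IsSeries G d y χ ω) :
    IsSeries G (fun n => ∑ kl ∈ Finset.HasAntidiagonal.antidiagonal n, c kl.1 * d kl.2) (x * y)
      (fun z => φ z * χ z) (fun z => ψ z * χ z + φ z * ω z) := by
  have hcoef : ∀ n : ℕ, (n : ℝ) * ∑ kl ∈ Finset.HasAntidiagonal.antidiagonal n, c kl.1 * d kl.2 =
      ∑ kl ∈ Finset.HasAntidiagonal.antidiagonal n, ((kl.1 : ℝ) * c kl.1) * d kl.2 +
      ∑ kl ∈ Finset.HasAntidiagonal.antidiagonal n, c kl.1 * ((kl.2 : ℝ) * d kl.2) := by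
    intro n
    rw [Finset.mul_sum, ← Finset.sum_add_distrib]
    refine Finset.sum_congr rfl fun kl hkl => ?_
    rw [← Finset.HasAntidiagonal.mem_antidiagonal.1 hkl]
    push_cast; ring
  have hcirc : ∀ {a : ℕ → ℝ}, (Summable fun k => |a k|) → ∀ z : ℂ, ‖z‖ = 1 →
      Summable fun k => ‖(a k : ℂ) * z ^ k‖ := by
    intro a ha z hz
    simpa [hz] using ha
  have hprod : ∀ (a b : ℕ → ℝ) (z : ℂ) (n : ℕ),
      ((∑ kl ∈ Finset.HasAntidiagonal.antidiagonal n, a kl.1 * b kl.2 : ℝ) : ℂ) * z ^ n =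
      ∑ kl ∈ Finset.HasAntidiagonal.antidiagonal n, ((a kl.1 : ℂ) * z ^ kl.1) * ((b kl.2 : ℂ) * z ^ kl.2) := by
    intro a b z n
    push_cast
    rw [Finset.sum_mul]
    refine Finset.sum_congr rfl fun kl hkl => ?_
    rw [← Finset.HasAntidiagonal.mem_antidiagonal.1 hkl, pow_add]
    ring
  refine ⟨?_, ?_, ?_, ?_, ?_⟩
  · exact summable_norm_sum_mul_antidiagonal_of_summable_norm (R := ℝ) h.summable h'.summable
  · simp only [hcoef]
    refine Summable.of_nonneg_of_le (fun _ => abs_nonneg _) (fun n => abs_add_le _ _)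
      (Summable.add ?_ ?_)
    · exact summable_norm_sum_mul_antidiagonal_of_summable_norm (R := ℝ)
        (f := fun k : ℕ => (k : ℝ) * c k) h.summable_deriv h'.summable
    · exact summable_norm_sum_mul_antidiagonal_of_summable_norm (R := ℝ)
        (g := fun k : ℕ => (k : ℝ) * d k) h.summable h'.summable_deriv
  · refine (hasSum_antidiagonal (Summable.of_nonneg_of_le (fun _ => norm_nonneg _)
      (fun k => norm_smul_pow_le hG _ k) h.summable) (Summable.of_nonneg_of_le
      (fun _ => norm_nonneg _) (fun k => norm_smul_pow_le hG _ k) h'.summable)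
      h.hasSum h'.hasSum).congr_fun fun n => ?_
    rw [Finset.sum_smul]
    refine Finset.sum_congr rfl fun kl hkl => ?_
    rw [← Finset.HasAntidiagonal.mem_antidiagonal.1 hkl, pow_add, smul_mul_smul_comm]
  · intro z hz
    exact (hasSum_antidiagonal (hcirc h.summable z hz) (hcirc h'.summable z hz)
      (h.hasSum_circle z hz) (h'.hasSum_circle z hz)).congr_fun fun n => hprod _ _ _ _
  · intro z hz
    refine ((hasSum_antidiagonal (hcirc h.summable_deriv z hz) (hcirc h'.summable z hz)
      (h.hasSum_deriv z hz) (h'.hasSum_circle z hz)).add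
      (hasSum_antidiagonal (hcirc h.summable z hz) (hcirc h'.summable_deriv z hz)
      (h.hasSum_circle z hz) (h'.hasSum_deriv z hz))).congr_fun fun n => ?_
    rw [hcoef, Complex.ofReal_add, add_mul, ← hprod (fun k : ℕ => (k : ℝ) * c k) d,
      ← hprod c (fun k : ℕ => (k : ℝ) * d k)]

theorem hasSum_of_two_le_eq_zero {M : Type*} [AddCommMonoid M] [TopologicalSpace M] (f : ℕ → M)
    (hf : ∀ k, 2 ≤ k → f k = 0) : HasSum f (f 0 + f 1) := by
  have := hasSum_sum_of_ne_finset_zero (L := .unconditional ℕ) (f := f) (s := Finset.range 2) (fun k hk => hf k (by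
    rw [Finset.mem_range] at hk; omega))
  simpa [Finset.sum_range_succ] using this

theorem isSeries_linear (a b : ℝ) :
    IsSeries G (fun k => if k = 0 then a else if k = 1 then b else 0) (a • 1 + b • G)
      (fun z => a + b * z) (fun z => b * z) := by
  have h0 : ∀ k : ℕ, 2 ≤ k → (if k = 0 then a else if k = 1 then b else 0) = 0 := fun k hk => by
    rw [if_neg (by omega), if_neg (by omega)]
  refine ⟨(hasSum_of_two_le_eq_zero _ fun k hk => ?_).summable, (hasSum_of_two_le_eq_zero _ fun k hk => ?_).summable, ?_, fun z _ => ?_,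
    fun z _ => ?_⟩
  · rw [h0 k hk, abs_zero]
  · rw [h0 k hk, mul_zero, abs_zero]
  · simpa using hasSum_of_two_le_eq_zero (fun k => (if k = 0 then a else if k = 1 then b else 0) • G ^ k) fun k hk => by
      simp only [h0 k hk, zero_smul]
  · simpa using hasSum_of_two_le_eq_zero (fun k => ((if k = 0 then a else if k = 1 then b else 0 : ℝ) : ℂ) * z ^ k)
      fun k hk => by simp only [h0 k hk, Complex.ofReal_zero, zero_mul]
  · simpa using hasSum_of_two_le_eq_zero (fun k : ℕ =>
      (((k : ℝ) * (if k = 0 then a else if k = 1 then b else 0) : ℝ) : ℂ) * z ^ k)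
      fun k hk => by simp only [h0 k hk, mul_zero, Complex.ofReal_zero, zero_mul]

/-- The truncated exponent k - 1 at k = 0 is harmless because of the factor k. -/
theorem exists_isSeries_pow [NormOneClass 𝔸] [CompleteSpace 𝔸] (hG : ‖G‖ ≤ 1) {c : ℕ → ℝ} {x : 𝔸} {φ ψ : ℂ → ℂ}
    (h : IsSeries G c x φ ψ) (k : ℕ) :
    ∃ d, IsSeries G d (x ^ k) (fun z => φ z ^ k) (fun z => k * φ z ^ (k - 1) * ψ z) := by
  induction k with
  | zero =>
    refine ⟨_, (?_ : IsSeries G (fun k => if k = 0 then 1 else if k = 1 then 0 else 0) _ _ _)⟩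
    have := isSeries_linear (G := G) 1 0
    simpa only [one_smul, zero_smul, add_zero, pow_zero, Complex.ofReal_one, Complex.ofReal_zero,
      zero_mul, Nat.cast_zero] using this
  | succ k ih =>
    obtain ⟨d, hd⟩ := ih
    have hm := hd.mul hG h
    refine ⟨_, hm.congr (pow_succ x k).symm (fun z => (pow_succ _ k).symm) fun z => ?_⟩
    rcases k with _ | k
    · simp
    · simp only [Nat.add_sub_cancel]
      push_cast
      ring

theorem hasSum_natCast_mul_pow_div_factorial (x : ℂ) :
    HasSum (fun k : ℕ => (k : ℂ) * (x ^ k / k.factorial)) (x * Complex.exp x) := by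
  rw [← hasSum_nat_add_iff' 1]
  have h := (NormedSpace.expSeries_div_hasSum_exp x).mul_left x
  rw [← Complex.exp_eq_exp_ℂ] at h
  simp only [Finset.range_one, Finset.sum_singleton, Nat.cast_zero, zero_mul, sub_zero]
  refine h.congr_fun fun k => ?_
  rw [Nat.factorial_succ, pow_succ]
  have : ((k : ℂ) + 1) ≠ 0 := by exact_mod_cast Nat.succ_ne_zero k
  have : (k.factorial : ℂ) ≠ 0 := by exact_mod_cast Nat.factorial_ne_zero k
  push_cast
  field_simp

theorem summable_abs_natCast_mul_pow_div_factorial (a : ℝ) :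
    Summable fun k : ℕ => |(k : ℝ) * (a ^ k / k.factorial)| := by
  have := (hasSum_natCast_mul_pow_div_factorial (a : ℂ)).summable.norm
  refine this.congr fun k => ?_
  rw [← Real.norm_eq_abs, ← Complex.norm_real]
  push_cast
  rfl

theorem summable_abs_pow_div_factorial (a : ℝ) :
    Summable fun k : ℕ => |a ^ k / k.factorial| :=
  (Real.summable_pow_div_factorial a).abs

theorem hasSum_pow_div_factorial_smul [CompleteSpace 𝔸] (a : ℝ) (x : 𝔸) :
    HasSum (fun k : ℕ => (a ^ k / k.factorial) • x ^ k) (NormedSpace.exp (a • x)) := by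
  refine (NormedSpace.exp_series_hasSum_exp' (𝕂 := ℝ) (a • x)).congr_fun fun k => ?_
  rw [smul_pow, smul_smul]
  congr 1
  ring

theorem isSeries_exp [CompleteSpace 𝔸] (a : ℝ) :
    IsSeries G (fun k => a ^ k / k.factorial) (NormedSpace.exp (a • G))
      (fun z => Complex.exp (a * z)) (fun z => a * z * Complex.exp (a * z)) := by
  refine ⟨summable_abs_pow_div_factorial a, summable_abs_natCast_mul_pow_div_factorial a,
    hasSum_pow_div_factorial_smul a G, fun z _ => ?_, fun z _ => ?_⟩
  · have h := NormedSpace.expSeries_div_hasSum_exp (a * z : ℂ)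
    rw [← Complex.exp_eq_exp_ℂ] at h
    refine h.congr_fun fun k => ?_
    push_cast; rw [mul_pow]; ring
  · refine (hasSum_natCast_mul_pow_div_factorial (a * z)).congr_fun fun k => ?_
    push_cast; rw [mul_pow]; ring

/-- The coefficients live on even indices, so every sum is pulled back along m ↦ 2m to the
exponential series. -/
theorem exists_isSeries_exp_sq [CompleteSpace 𝔸] (a : ℝ) :
    ∃ c, IsSeries G c (NormedSpace.exp (a • G ^ 2))
      (fun z => Complex.exp (a * z ^ 2)) (fun z => 2 * a * z ^ 2 * Complex.exp (a * z ^ 2)) := by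
  have hinj : Function.Injective fun m : ℕ => 2 * m := fun i j h => by simpa using h
  set c : ℕ → ℝ := fun k => if Even k then a ^ (k / 2) / (k / 2).factorial else 0 with hc
  have hodd : ∀ k ∉ Set.range (fun m : ℕ => 2 * m), c k = 0 := by
    intro k hk
    rw [hc]
    exact if_neg fun ⟨r, hr⟩ => hk ⟨r, by simp only; omega⟩
  have heven : ∀ m : ℕ, c (2 * m) = a ^ m / m.factorial := by
    intro m
    simp [hc]
  refine ⟨c, ?_, ?_, ?_, fun z hz => ?_, fun z hz => ?_⟩
  · rw [← hinj.summable_iff fun k hk => by rw [hodd k hk, abs_zero]]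
    exact (summable_abs_pow_div_factorial a).congr fun m => by
      rw [Function.comp_apply, heven]
  · rw [← hinj.summable_iff fun k hk => by rw [hodd k hk, mul_zero, abs_zero]]
    refine ((summable_abs_natCast_mul_pow_div_factorial a).mul_left 2).congr fun m => ?_
    rw [Function.comp_apply, heven]
    push_cast
    rw [mul_assoc, abs_mul 2, abs_two]
  · rw [← hinj.hasSum_iff fun k hk => by rw [hodd k hk, zero_smul]]
    refine (hasSum_pow_div_factorial_smul a (G ^ 2)).congr_fun fun m => ?_
    rw [Function.comp_apply, heven, pow_mul]
  · rw [← hinj.hasSum_iff fun k hk => by rw [hodd k hk, Complex.ofReal_zero, zero_mul]]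
    have h := NormedSpace.expSeries_div_hasSum_exp (a * z ^ 2 : ℂ)
    rw [← Complex.exp_eq_exp_ℂ] at h
    refine h.congr_fun fun m => ?_
    rw [Function.comp_apply, heven, pow_mul, mul_pow]
    push_cast; ring
  · rw [← hinj.hasSum_iff fun k hk => by
      rw [hodd k hk, mul_zero, Complex.ofReal_zero, zero_mul]]
    have h := (hasSum_natCast_mul_pow_div_factorial (a * z ^ 2)).mul_left 2
    rw [show 2 * ((a : ℂ) * z ^ 2 * Complex.exp (a * z ^ 2)) =
      2 * a * z ^ 2 * Complex.exp (a * z ^ 2) by ring] at h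
    refine h.congr_fun fun m => ?_
    rw [Function.comp_apply, heven, pow_mul, mul_pow]
    push_cast; ring

/-- The exponential of a quadratic polynomial as a power series. -/
theorem exists_isSeries_exp_quadratic [NormOneClass 𝔸] [CompleteSpace 𝔸] (hG : ‖G‖ ≤ 1) (a₀ a₁ a₂ : ℝ) :
    ∃ c, IsSeries G c (NormedSpace.exp (a₀ • 1 + a₁ • G + a₂ • G ^ 2))
      (fun z => Complex.exp (a₀ + a₁ * z + a₂ * z ^ 2))
      (fun z => (a₁ * z + 2 * a₂ * z ^ 2) * Complex.exp (a₀ + a₁ * z + a₂ * z ^ 2)) := by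
  obtain ⟨c, hc⟩ := exists_isSeries_exp_sq (G := G) a₂
  -- The constant term of the exponent enters as the constant series exp a₀, that is, a linear
  -- series of slope zero.
  have h := ((isSeries_linear (G := G) (Real.exp a₀) 0).mul hG (isSeries_exp a₁)).mul hG hc
  refine ⟨_, h.congr ?_ (fun z => ?_) fun z => ?_⟩
  · rw [exp_add_real, exp_add_real, exp_smul_one_real, zero_smul, add_zero]
  · rw [Complex.exp_add, Complex.exp_add]
    push_cast
    ring
  · rw [Complex.exp_add, Complex.exp_add]
    push_cast
    ring

end Series

/-! ### Moments of `exp (-w (1 - cos t))` over the circle -/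

/-- The mean over the circle of `(2 (1 - cos t)) ^ m * exp (-w (1 - cos t))`. -/
noncomputable def circleMoment (m : ℕ) (w : ℝ) : ℝ :=
  (2 * Real.pi)⁻¹ * ∫ t in (-Real.pi)..Real.pi,
    (2 * (1 - Real.cos t)) ^ m * Real.exp (-(w * (1 - Real.cos t)))

theorem one_sub_cos_nonneg (t : ℝ) : 0 ≤ 1 - Real.cos t := by
  linarith [Real.cos_le_one t]

theorem circleMoment_le_of_nonneg {w : ℝ} (hw : 0 ≤ w) (m : ℕ) : circleMoment m w ≤ 4 ^ m := by
  have hπ := Real.pi_pos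
  have h : ∫ t in (-Real.pi)..Real.pi,
      (2 * (1 - Real.cos t)) ^ m * Real.exp (-(w * (1 - Real.cos t))) ≤
      ∫ t in (-Real.pi)..Real.pi, (4 : ℝ) ^ m := by
    refine intervalIntegral.integral_mono_on (by linarith)
      (Continuous.intervalIntegrable (by fun_prop) _ _) intervalIntegrable_const fun t _ => ?_
    have h1 := one_sub_cos_nonneg t
    have h2 : 2 * (1 - Real.cos t) ≤ 4 := by linarith [Real.neg_one_le_cos t]
    have h3 : Real.exp (-(w * (1 - Real.cos t))) ≤ 1 := Real.exp_le_one_iff.2 (by nlinarith)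
    calc _ ≤ (4 : ℝ) ^ m * 1 := by gcongr
      _ = _ := mul_one _
  rw [intervalIntegral.integral_const, smul_eq_mul] at h
  unfold circleMoment
  calc _ ≤ (2 * Real.pi)⁻¹ * ((Real.pi - -Real.pi) * 4 ^ m) := by gcongr
    _ = _ := by field_simp; ring

theorem circleMoment_one_le_two {w : ℝ} (hw : 0 ≤ w) : circleMoment 1 w ≤ 2 := by
  have hπ := Real.pi_pos
  have h : ∫ t in (-Real.pi)..Real.pi,
      (2 * (1 - Real.cos t)) ^ 1 * Real.exp (-(w * (1 - Real.cos t))) ≤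
      ∫ t in (-Real.pi)..Real.pi, (2 - 2 * Real.cos t) := by
    refine intervalIntegral.integral_mono_on (by linarith)
      (Continuous.intervalIntegrable (by fun_prop) _ _)
      (Continuous.intervalIntegrable (by fun_prop) _ _) fun t _ => ?_
    have h1 := one_sub_cos_nonneg t
    have h3 : Real.exp (-(w * (1 - Real.cos t))) ≤ 1 := Real.exp_le_one_iff.2 (by nlinarith)
    nlinarith
  have e : ∫ t in (-Real.pi)..Real.pi, (2 - 2 * Real.cos t) = 4 * Real.pi := by
    rw [intervalIntegral.integral_sub (by simp)
      (Continuous.intervalIntegrable (by fun_prop) _ _), intervalIntegral.integral_const_mul,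
      integral_cos, intervalIntegral.integral_const]
    simp
    ring
  rw [e] at h
  unfold circleMoment
  calc _ ≤ (2 * Real.pi)⁻¹ * (4 * Real.pi) := by gcongr
    _ = _ := by field_simp; ring

theorem integral_pow_mul_exp_neg_mul_sq {β : ℝ} (hβ : 0 < β) (m : ℕ) :
    ∫ t : ℝ, t ^ (2 * m) * Real.exp (-β * t ^ 2) =
      β ^ (-((2 * m : ℝ) + 1) / 2) * Real.Gamma (((2 * m : ℝ) + 1) / 2) := by
  have h := integral_rpow_mul_exp_neg_mul_rpow (p := 2) (q := 2 * m) (b := β) (by norm_num)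
    (by have : (0 : ℝ) ≤ m := Nat.cast_nonneg m
        linarith) hβ
  have h2 := integral_comp_abs (f := fun x : ℝ => x ^ (2 * m) * Real.exp (-β * x ^ 2))
  have e1 : ∀ x : ℝ, |x| ^ (2 * m) * Real.exp (-β * |x| ^ 2) =
      x ^ (2 * m) * Real.exp (-β * x ^ 2) := fun x => by
    rw [pow_mul, sq_abs, ← pow_mul]
  simp only [e1] at h2
  rw [h2]
  have e2 : ∀ x : ℝ, x ^ (2 * (m : ℝ)) * Real.exp (-β * x ^ (2 : ℝ)) =
      x ^ (2 * m) * Real.exp (-β * x ^ 2) := fun x => by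
    rw [← Real.rpow_natCast x (2 * m), ← Real.rpow_natCast x 2]
    push_cast
    rfl
  simp only [e2] at h
  rw [h]
  ring

/-- On [-π, π] one has 2t²/π² ≤ 1 - cos t ≤ t²/2. The lower bound goes into the exponential and the
upper one into the power; extending the integral to the whole line leaves a Gaussian moment. -/
theorem circleMoment_le_integral {w : ℝ} (hw : 0 < w) (m : ℕ) :
    circleMoment m w ≤
      (2 * Real.pi)⁻¹ * ∫ t : ℝ, t ^ (2 * m) * Real.exp (-(2 * w / Real.pi ^ 2) * t ^ 2) := by
  have hπ := Real.pi_pos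
  have hβ : 0 < 2 * w / Real.pi ^ 2 := by positivity
  have hint : Integrable fun t : ℝ => t ^ (2 * m) * Real.exp (-(2 * w / Real.pi ^ 2) * t ^ 2) := by
    have := integrable_rpow_mul_exp_neg_mul_sq hβ (s := (2 * m : ℕ)) (by
      have : (0 : ℝ) ≤ (2 * m : ℕ) := Nat.cast_nonneg _
      linarith)
    simpa only [Real.rpow_natCast] using this
  unfold circleMoment
  refine mul_le_mul_of_nonneg_left ?_ (by positivity)
  rw [intervalIntegral.integral_of_le (by linarith)]
  refine (setIntegral_mono_on ?_ hint.integrableOn measurableSet_Ioc fun t ht => ?_).trans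
    (setIntegral_le_integral hint (Filter.Eventually.of_forall fun t => ?_))
  · exact (Continuous.integrableOn_Icc (by fun_prop)).mono_set Set.Ioc_subset_Icc_self
  · have h1 := one_sub_cos_nonneg t
    have h2 : 2 * (1 - Real.cos t) ≤ t ^ 2 := by
      have := Real.one_sub_sq_div_two_le_cos (x := t)
      linarith
    have h3 : 2 / Real.pi ^ 2 * t ^ 2 ≤ 1 - Real.cos t := by
      have := Real.cos_le_one_sub_mul_cos_sq (x := t) (abs_le.2 ⟨ht.1.le, ht.2⟩)
      linarith
    rw [pow_mul]
    gcongr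
    calc -(w * (1 - Real.cos t)) ≤ -(w * (2 / Real.pi ^ 2 * t ^ 2)) := by gcongr
      _ = _ := by ring
  · simp only [Pi.zero_apply, pow_mul]
    positivity

/-- The constant in front of `w ^ (-1 / 2)` in the bound for the moment of order zero. -/
noncomputable def momentConst : ℝ := √(Real.pi / 2) / 2

theorem rpow_neg_half_scale {w : ℝ} (hw : 0 < w) :
    (2 * Real.pi)⁻¹ * ((2 * w / Real.pi ^ 2) ^ (-(1 : ℝ) / 2) * √Real.pi) = momentConst / √w := by
  have hπ := Real.pi_pos
  rw [show (-(1 : ℝ) / 2) = -(1 / 2) by ring, Real.rpow_neg (by positivity), ← Real.sqrt_eq_rpow,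
    Real.sqrt_div (by positivity), Real.sqrt_sq hπ.le, Real.sqrt_mul (by norm_num), momentConst,
    Real.sqrt_div hπ.le]
  have : √w ≠ 0 := (Real.sqrt_pos.2 hw).ne'
  have : √2 ≠ 0 := by positivity
  field_simp

theorem rpow_sub_natCast_scale {β : ℝ} (hβ : 0 < β) (m : ℕ) :
    β ^ (-((2 * m : ℝ) + 1) / 2) = β ^ (-(1 : ℝ) / 2) / β ^ m := by
  rw [show (-((2 * m : ℝ) + 1) / 2) = -(1 : ℝ) / 2 - m by ring, Real.rpow_sub hβ, Real.rpow_natCast]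

theorem circleMoment_zero_le {w : ℝ} (hw : 0 < w) : circleMoment 0 w ≤ momentConst / √w := by
  have hβ : 0 < 2 * w / Real.pi ^ 2 := by have := Real.pi_pos; positivity
  refine (circleMoment_le_integral hw 0).trans (le_of_eq ?_)
  rw [integral_pow_mul_exp_neg_mul_sq hβ, ← rpow_neg_half_scale hw]
  norm_num [Real.Gamma_one_half_eq]

theorem circleMoment_one_le {w : ℝ} (hw : 0 < w) :
    circleMoment 1 w ≤ momentConst / √w * (Real.pi ^ 2 / (4 * w)) := by
  have hπ := Real.pi_pos
  have hβ : 0 < 2 * w / Real.pi ^ 2 := by positivity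
  refine (circleMoment_le_integral hw 1).trans (le_of_eq ?_)
  rw [integral_pow_mul_exp_neg_mul_sq hβ, ← rpow_neg_half_scale hw, rpow_sub_natCast_scale hβ]
  have hG : Real.Gamma ((2 * (1 : ℕ) + 1) / 2) = √Real.pi / 2 := by
    rw [show ((2 * ((1 : ℕ) : ℝ) + 1) / 2) = 1 / 2 + 1 by norm_num, Real.Gamma_add_one (by norm_num),
      Real.Gamma_one_half_eq]
    ring
  rw [hG]
  field_simp
  norm_num

theorem circleMoment_two_le {w : ℝ} (hw : 0 < w) :
    circleMoment 2 w ≤ momentConst / √w * (3 * (Real.pi ^ 2 / (4 * w)) ^ 2) := by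
  have hπ := Real.pi_pos
  have hβ : 0 < 2 * w / Real.pi ^ 2 := by positivity
  refine (circleMoment_le_integral hw 2).trans (le_of_eq ?_)
  rw [integral_pow_mul_exp_neg_mul_sq hβ, ← rpow_neg_half_scale hw, rpow_sub_natCast_scale hβ]
  have hG : Real.Gamma ((2 * (2 : ℕ) + 1) / 2) = 3 / 4 * √Real.pi := by
    rw [show ((2 * ((2 : ℕ) : ℝ) + 1) / 2) = 1 / 2 + 1 + 1 by norm_num,
      Real.Gamma_add_one (by norm_num), Real.Gamma_add_one (by norm_num),
      Real.Gamma_one_half_eq]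
    ring
  rw [hG]
  field_simp
  norm_num

/-! ### The generating functions on the unit circle -/

theorem norm_exp_mul_I_sub_one_sq (t : ℝ) :
    ‖Complex.exp (t * Complex.I) - 1‖ ^ 2 = 2 * (1 - Real.cos t) := by
  rw [Complex.sq_norm, Complex.normSq_apply, Complex.exp_mul_I]
  simp [← Complex.ofReal_cos, ← Complex.ofReal_sin]
  nlinarith [Real.sin_sq_add_cos_sq t]

/-- The squared modulus is exactly 1 - 2pq(1 - cos t), and 1 + x ≤ exp x. -/
theorem norm_mix_le {p q : ℝ} (hpq : p + q = 1) (t : ℝ) :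
    ‖(q : ℂ) + p * Complex.exp (t * Complex.I)‖ ≤ Real.exp (-(p * q * (1 - Real.cos t))) := by
  refine le_of_sq_le_sq ?_ (Real.exp_pos _).le
  have e : ‖(q : ℂ) + p * Complex.exp (t * Complex.I)‖ ^ 2 = 1 - 2 * (p * q * (1 - Real.cos t)) := by
    rw [Complex.sq_norm, Complex.normSq_apply, Complex.exp_mul_I]
    simp [← Complex.ofReal_cos, ← Complex.ofReal_sin]
    have hs := Real.sin_sq_add_cos_sq t
    have hq : q = 1 - p := by linarith
    subst hq
    linear_combination p ^ 2 * hs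
  rw [e, ← Real.exp_nat_mul]
  have := Real.add_one_le_exp (((2 : ℕ) : ℝ) * -(p * q * (1 - Real.cos t)))
  push_cast at this ⊢
  linarith

/-- The exponent of the generating function, `j (u - u ^ 2 / 2) - r q u` with `u = p (z - 1)`. -/
noncomputable def circleExponent (p q j r : ℝ) (z : ℂ) : ℂ :=
  ((-(j * (p + p ^ 2 / 2)) + r * q * p : ℝ) : ℂ) + ((j * (p + p ^ 2) - r * q * p : ℝ) : ℂ) * z +
    ((-(j * (p ^ 2 / 2)) : ℝ) : ℂ) * z ^ 2

/-- For u = p(z - 1) the real part of u - u²/2 equals -pq(1 - cos t) - p²(1 - cos t)². The last term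
has a favourable sign and is dropped, so one factor exp(u - u²/2) decays at least as fast as the
bound for q + pz. -/
theorem re_circleExponent_le {p q j r : ℝ} (hpq : p + q = 1) (hj : 0 ≤ j) (t : ℝ) :
    (circleExponent p q j r (Complex.exp (t * Complex.I))).re ≤
      -(p * q * (1 - Real.cos t)) * (j - r) := by
  have hs := Real.sin_sq_add_cos_sq t
  have hc := Real.cos_le_one t
  have e : (circleExponent p q j r (Complex.exp (t * Complex.I))).re =
      -(j * (p + p ^ 2 / 2)) + r * q * p + (j * (p + p ^ 2) - r * q * p) * Real.cos t
        - j * (p ^ 2 / 2) * (Real.cos t ^ 2 - Real.sin t ^ 2) := by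
    rw [circleExponent, Complex.exp_mul_I]
    simp [← Complex.ofReal_cos, ← Complex.ofReal_sin, pow_two]
    ring
  rw [e]
  have hsin : Real.sin t ^ 2 = 1 - Real.cos t ^ 2 := by linarith
  rw [hsin]
  have hq : q = 1 - p := by linarith
  subst hq
  have h1 : 0 ≤ j * p ^ 2 * (1 - Real.cos t) ^ 2 := by positivity
  nlinarith

theorem norm_exp_circleExponent_le {p q j r : ℝ} (hpq : p + q = 1) (hj : 0 ≤ j)
    (t : ℝ) : ‖Complex.exp (circleExponent p q j r (Complex.exp (t * Complex.I)))‖ ≤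
      Real.exp (-(p * q * (1 - Real.cos t)) * (j - r)) := by
  rw [Complex.norm_exp]
  exact Real.exp_le_exp.2 (re_circleExponent_le hpq hj t)

theorem norm_mix_pow_mul_exp_le {p q r : ℝ} (hpq : p + q = 1)
    (k j : ℕ) (t : ℝ) :
    ‖((q : ℂ) + p * Complex.exp (t * Complex.I)) ^ k *
      Complex.exp (circleExponent p q j r (Complex.exp (t * Complex.I)))‖ ≤
      Real.exp (-(p * q * (1 - Real.cos t)) * (k + j - r)) := by
  rw [norm_mul, norm_pow]
  calc _ ≤ Real.exp (-(p * q * (1 - Real.cos t))) ^ k *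
        Real.exp (-(p * q * (1 - Real.cos t)) * (j - r)) := by
        gcongr
        · exact norm_mix_le hpq t
        · exact norm_exp_circleExponent_le hpq (Nat.cast_nonneg j) t
    _ = _ := by
        rw [← Real.exp_nat_mul, ← Real.exp_add]
        congr 1
        ring

/-- The centred derivative of the generating function. -/
theorem norm_centred_deriv_le {p q r : ℝ} (hp : 0 ≤ p) (hq : 0 ≤ q) (hpq : p + q = 1) (hr : 0 ≤ r)
    (k j : ℕ) (t : ℝ) {z : ℂ} (hz : z = Complex.exp (t * Complex.I)) :
    ‖(k * (q + p * z) ^ (k - 1) * (p * z) * Complex.exp (circleExponent p q j r z) +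
        (q + p * z) ^ k * ((((j * (p + p ^ 2) - r * q * p : ℝ) : ℂ) * z +
          2 * ((-(j * (p ^ 2 / 2)) : ℝ) : ℂ) * z ^ 2) * Complex.exp (circleExponent p q j r z))) -
      ((p * (k + j - r * q) : ℝ) : ℂ) *
        ((q + p * z) ^ k * Complex.exp (circleExponent p q j r z))‖ ≤
      Real.exp (-(p * q * (1 - Real.cos t)) * (k + j - 1 - r)) *
        ((k + j + r) * (p * q) * ‖z - 1‖ + j * p ^ 2 * ‖z - 1‖ ^ 2) := by
  have hqc : (q : ℂ) = 1 - p := by rw [← Complex.ofReal_one, ← Complex.ofReal_sub]; congr 1; linarith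
  set X := Complex.exp (circleExponent p q j r z) with hX
  set M := Real.exp (-(p * q * (1 - Real.cos t)) * (k + j - 1 - r)) with hM
  have hh := one_sub_cos_nonneg t
  have hφ : ‖(q + p * z) ^ k * X‖ ≤ M := by
    rw [hX, hz]
    refine (norm_mix_pow_mul_exp_le hpq k j t).trans (Real.exp_le_exp.2 ?_)
    have : 0 ≤ p * q * (1 - Real.cos t) := by positivity
    nlinarith
  have hzn : ‖z‖ = 1 := by rw [hz]; exact Complex.norm_exp_ofReal_mul_I t
  -- The centre p(k + j - rq) is the logarithmic derivative at z = 1, so a factor z - 1 splits off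
  -- everywhere. The first part has one power of q + pz fewer, hence the exponent k + j - 1 - r in
  -- the bound. In the second part 1 - pz = q - p(z - 1) separates the main order pq|z - 1| from the
  -- correction p²|z - 1|².
  have e : (k * (q + p * z) ^ (k - 1) * (p * z) * X +
        (q + p * z) ^ k * ((((j * (p + p ^ 2) - r * q * p : ℝ) : ℂ) * z +
          2 * ((-(j * (p ^ 2 / 2)) : ℝ) : ℂ) * z ^ 2) * X)) -
      ((p * (k + j - r * q) : ℝ) : ℂ) * ((q + p * z) ^ k * X) =
      k * ((p * q : ℝ) * (z - 1)) * ((q + p * z) ^ (k - 1) * X) +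
      (j * (p * (z - 1)) * (1 - p * z) - r * q * (p * (z - 1))) * ((q + p * z) ^ k * X) := by
    rcases k with _ | k
    · push_cast
      ring
    · simp only [Nat.add_sub_cancel, pow_succ]
      push_cast
      rw [hqc]
      ring
  rw [e]
  have h1 : ‖(k : ℂ) * ((p * q : ℝ) * (z - 1)) * ((q + p * z) ^ (k - 1) * X)‖ ≤
      k * (p * q * ‖z - 1‖) * M := by
    rcases k with _ | k
    · simp
    · rw [norm_mul, norm_mul, norm_mul, Complex.norm_real, Real.norm_of_nonneg (by positivity),
        Complex.norm_natCast]
      gcongr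
      rw [hX, hz]
      refine (norm_mix_pow_mul_exp_le hpq _ j t).trans (Real.exp_le_exp.2 (le_of_eq ?_))
      rw [Nat.add_sub_cancel]
      push_cast
      ring
  have h2 : ‖(j : ℂ) * (p * (z - 1)) * (1 - p * z) - r * q * (p * (z - 1))‖ ≤
      j * (p * ‖z - 1‖) * (q + p * ‖z - 1‖) + r * q * (p * ‖z - 1‖) := by
    have h3 : ‖1 - p * z‖ ≤ q + p * ‖z - 1‖ := by
      have : 1 - p * z = (q : ℂ) - p * (z - 1) := by rw [hqc]; ring
      rw [this]
      refine (norm_sub_le _ _).trans ?_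
      rw [norm_mul, Complex.norm_real, Complex.norm_real, Real.norm_of_nonneg hp,
        Real.norm_of_nonneg hq]
    refine (norm_sub_le _ _).trans ?_
    simp only [norm_mul, Complex.norm_real, Real.norm_of_nonneg hp,
        Real.norm_of_nonneg hq, Real.norm_of_nonneg hr, Complex.norm_natCast]
    gcongr
  refine (norm_add_le _ _).trans ?_
  calc _ ≤ k * (p * q * ‖z - 1‖) * M +
        (j * (p * ‖z - 1‖) * (q + p * ‖z - 1‖) + r * q * (p * ‖z - 1‖)) * M := by
        gcongr
        rw [norm_mul]
        gcongr
    _ = _ := by ring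

/-- A small η keeps the coefficient of the main term close to 1; the large factor 1 + 1/η falls on
the correction, which is later of relative order 1/(nq³). -/
theorem add_sq_le_weighted (a b : ℝ) {η : ℝ} (hη : 0 < η) :
    (a + b) ^ 2 ≤ (1 + η) * a ^ 2 + (1 + 1 / η) * b ^ 2 := by
  have h : 0 ≤ (η * a - b) ^ 2 / η := by positivity
  have e : (1 + η) * a ^ 2 + (1 + 1 / η) * b ^ 2 - (a + b) ^ 2 = (η * a - b) ^ 2 / η := by
    field_simp
    ring
  linarith

/-! ### Numerical bounds for the moments -/

theorem momentConst_le : momentConst ≤ 0.6268 := by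
  have h : √(Real.pi / 2) ≤ 1.2536 := by
    rw [Real.sqrt_le_left (by norm_num)]
    have := Real.pi_lt_d4
    norm_num at this ⊢
    linarith
  unfold momentConst
  norm_num at h ⊢
  linarith

theorem pi_sq_div_four_le : Real.pi ^ 2 / 4 ≤ 2.4675 := by
  have := Real.pi_lt_d4
  have := Real.pi_pos
  norm_num at *
  nlinarith

/-- With w of order V², the moment of index m is of order V to the power -(2m + 1), with all
constants made rational. -/
theorem circleMoment_scaled_le {w V κ : ℝ} (hV : 0 < V) (hκ : 0 < κ) (hw : (κ * V) ^ 2 ≤ w) :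
    circleMoment 0 w ≤ 0.6268 / κ / V ∧
    circleMoment 1 w ≤ 0.6268 * 2.4675 / κ ^ 3 / V ^ 3 ∧
    circleMoment 2 w ≤ 0.6268 * (3 * 2.4675 ^ 2) / κ ^ 5 / V ^ 5 := by
  have hpos : 0 < κ * V := by positivity
  have hw0 : 0 < w := lt_of_lt_of_le (by positivity) hw
  have hs : κ * V ≤ √w := Real.le_sqrt_of_sq_le hw
  have h0 : momentConst / √w ≤ 0.6268 / (κ * V) := by
    gcongr
    exact momentConst_le
  have h1 : Real.pi ^ 2 / (4 * w) ≤ 2.4675 / (κ * V) ^ 2 := by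
    rw [← div_div]
    gcongr
    exact pi_sq_div_four_le
  have h1' : 0 ≤ Real.pi ^ 2 / (4 * w) := by positivity
  refine ⟨(circleMoment_zero_le hw0).trans (h0.trans (le_of_eq ?_)),
    (circleMoment_one_le hw0).trans ?_, (circleMoment_two_le hw0).trans ?_⟩
  · rw [div_div]
  · calc _ ≤ 0.6268 / (κ * V) * (2.4675 / (κ * V) ^ 2) := by gcongr
      _ = _ := by field_simp
  · calc _ ≤ 0.6268 / (κ * V) * (3 * (2.4675 / (κ * V) ^ 2) ^ 2) := by gcongr
      _ = _ := by field_simp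

theorem circleMoment_nonneg (m : ℕ) (w : ℝ) : 0 ≤ circleMoment m w := by
  have hπ := Real.pi_pos
  refine mul_nonneg (by positivity) (intervalIntegral.integral_nonneg (by linarith) fun t _ => ?_)
  have := one_sub_cos_nonneg t
  positivity

/-! ### Norms of the factors left after smoothing -/

section Norm

variable {𝔸 : Type*} [NormedCommRing 𝔸] [NormedAlgebra ℝ 𝔸] [NormOneClass 𝔸] [CompleteSpace 𝔸]

/-- The product of a power of `q + p G`, a power of the exponential `exp (u - u ^ 2 / 2)` and
`exp (-r q u)`, where `u = p (G - 1)`. -/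
noncomputable def mixProd (G : 𝔸) (p q r : ℝ) (k j : ℕ) : 𝔸 :=
  (q • 1 + p • G) ^ k * NormedSpace.exp ((j : ℝ) • (p • (G - 1) - (1 / 2 : ℝ) • (p • (G - 1)) ^ 2)
    - (r * q) • (p • (G - 1)))

/-- The product is a power of a linear series times the exponential of a quadratic in G, so
`sq_tsum_abs_le` applies with centre p(k + j - rq). Squaring the moduli doubles the exponent, which
explains w, and ‖z - 1‖² = 2(1 - cos t) turns powers of ‖z - 1‖ into moment indices. -/
theorem norm_mixProd_sq_le {G : 𝔸} (hG : ‖G‖ ≤ 1) {p q r b η : ℝ} (hp : 0 ≤ p) (hq : 0 ≤ q)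
    (hpq : p + q = 1) (hr : 0 ≤ r) (hb : 0 < b) (hη : 0 < η) (k j : ℕ) {w : ℝ}
    (hw : w = 2 * (p * q) * (k + j - 1 - r)) :
    ‖mixProd G p q r k j‖ ^ 2 ≤ (1 + Real.pi * b) *
      (circleMoment 0 w + ((1 + η) * ((k + j + r) * (p * q)) ^ 2 * circleMoment 1 w +
        (1 + 1 / η) * (j * p ^ 2) ^ 2 * circleMoment 2 w) / b ^ 2) := by
  obtain ⟨c₁, h₁⟩ := exists_isSeries_pow hG (isSeries_linear (G := G) q p) k
  obtain ⟨c₂, h₂⟩ := exists_isSeries_exp_quadratic hG (-(j * (p + p ^ 2 / 2)) + r * q * p)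
    (j * (p + p ^ 2) - r * q * p) (-(j * (p ^ 2 / 2)))
  have h := h₁.mul hG h₂
  have hx : (q • 1 + p • G) ^ k * NormedSpace.exp ((-(j * (p + p ^ 2 / 2)) + r * q * p) • 1 +
      (j * (p + p ^ 2) - r * q * p) • G + (-(j * (p ^ 2 / 2))) • G ^ 2) = mixProd G p q r k j := by
    unfold mixProd
    congr 2
    have hsq : (p • (G - 1)) ^ 2 = p ^ 2 • (G ^ 2 - (2 : ℝ) • G + 1) := by
      rw [smul_pow, ofNat_smul_eq_nsmul, two_nsmul]
      congr 1
      ring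
    rw [hsq]
    module
  rw [hx] at h
  refine (pow_le_pow_left₀ (norm_nonneg _) (h.norm_le hG) 2).trans ?_
  have hb2 : 0 < b ^ 2 := by positivity
  have hmain := sq_tsum_abs_le h.summable h.summable_deriv h.hasSum_circle h.hasSum_deriv
    (p * (k + j - r * q)) hb
    (a₀ := fun t => (2 * (1 - Real.cos t)) ^ 0 * Real.exp (-(w * (1 - Real.cos t))))
    (a₁ := fun t => (1 + η) * ((k + j + r) * (p * q)) ^ 2 *
        ((2 * (1 - Real.cos t)) ^ 1 * Real.exp (-(w * (1 - Real.cos t)))) +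
      (1 + 1 / η) * (j * p ^ 2) ^ 2 *
        ((2 * (1 - Real.cos t)) ^ 2 * Real.exp (-(w * (1 - Real.cos t)))))
    (by fun_prop) (by fun_prop) (fun t => by simp only [Real.cos_add_two_pi])
    (fun t => by simp only [Real.cos_add_two_pi]) ?_ ?_
  · refine hmain.trans (le_of_eq ?_)
    congr 2
    rw [intervalIntegral.integral_add (Continuous.intervalIntegrable (by fun_prop) _ _)
      (Continuous.intervalIntegrable (by fun_prop) _ _), intervalIntegral.integral_const_mul,
      intervalIntegral.integral_const_mul]
    unfold circleMoment
    ring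
  · intro t
    have hb := norm_mix_pow_mul_exp_le (r := r) hpq k j t
    have hh := one_sub_cos_nonneg t
    have hle : Real.exp (-(p * q * (1 - Real.cos t)) * (k + j - r)) ≤
        Real.exp (-(p * q * (1 - Real.cos t)) * (k + j - 1 - r)) := by
      refine Real.exp_le_exp.2 ?_
      have : 0 ≤ p * q * (1 - Real.cos t) := by positivity
      nlinarith
    calc _ ≤ Real.exp (-(p * q * (1 - Real.cos t)) * (k + j - 1 - r)) ^ 2 := by
          gcongr
          exact hb.trans hle
      _ = _ := by
          rw [pow_zero, one_mul, ← Real.exp_nat_mul, hw]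
          congr 1
          push_cast
          ring
  · intro t
    have hd := norm_centred_deriv_le hp hq hpq hr k j t rfl
    refine (pow_le_pow_left₀ (norm_nonneg _) hd 2).trans ?_
    rw [mul_pow]
    have h4 : ‖Complex.exp (t * Complex.I) - 1‖ ^ 4 = (2 * (1 - Real.cos t)) ^ 2 := by
      rw [← norm_exp_mul_I_sub_one_sq]; ring
    calc _ ≤ Real.exp (-(p * q * (1 - Real.cos t)) * (k + j - 1 - r)) ^ 2 *
          ((1 + η) * ((k + j + r) * (p * q) * ‖Complex.exp (t * Complex.I) - 1‖) ^ 2 +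
          (1 + 1 / η) * (j * p ^ 2 * ‖Complex.exp (t * Complex.I) - 1‖ ^ 2) ^ 2) := by
          gcongr
          exact add_sq_le_weighted _ _ hη
      _ = _ := by
          have e : Real.exp (-(p * q * (1 - Real.cos t)) * (k + j - 1 - r)) ^ 2 =
              Real.exp (-(w * (1 - Real.cos t))) := by
            rw [← Real.exp_nat_mul, hw]
            congr 1
            push_cast
            ring
          rw [e, mul_pow _ ‖_‖ 2, norm_exp_mul_I_sub_one_sq]
          ring

/-- The natural scale is the variance v = npq. If v ≥ 1/2, the width b = β√v makes the estimate
scale-free: the powers of V = √v cancel except for 1/V ≤ 1/0.7. If v ≤ 1/2, the trivial moment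
bounds with a fixed width suffice. The two regimes are the two entries of the maximum. -/
theorem norm_mixProd_sq_le_of_bounds {G : 𝔸} (hG : ‖G‖ ≤ 1) {p q r : ℝ} (hp : 0 ≤ p) (hq : 0 < q)
    (hpq : p + q = 1) (hr : 0 ≤ r) {n k j : ℕ} (hn : 0 < n) (hj : j ≤ n) {ℓ κ η β b : ℝ}
    (hℓ : k + j + r ≤ ℓ * n) (hκ : 0 < κ) (hκn : κ ^ 2 * n ≤ 2 * (k + j - 1 - r)) (hη : 0 < η)
    (hβ : 0 < β) (hb : 0 < b) :
    ‖mixProd G p q r k j‖ ^ 2 ≤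
      max ((1 / 0.7 + 3.1416 * β) * (0.6268 / κ + ((1 + η) * ℓ ^ 2 * (0.6268 * 2.4675 / κ ^ 3) +
          (1 + 1 / η) * (0.6268 * (3 * 2.4675 ^ 2) / κ ^ 5) * (1 / (n * q ^ 3))) / β ^ 2))
        ((1 + 3.1416 * b) * (1 + ((1 + η) * (ℓ ^ 2 / 2) +
          (1 + 1 / η) * 2 * (1 / (n * q ^ 3))) / b ^ 2)) := by
  have hn0 : (0 : ℝ) < n := by exact_mod_cast hn
  have hjn : (j : ℝ) ≤ n := by exact_mod_cast hj
  have hp1 : p ≤ 1 := by linarith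
  set v : ℝ := n * p * q with hv
  have hv0 : 0 ≤ v := by positivity
  set w : ℝ := 2 * (p * q) * (k + j - 1 - r) with hw
  have hpq0 : 0 ≤ p * q := by positivity
  have hwv : κ ^ 2 * v ≤ w := by
    calc κ ^ 2 * v = p * q * (κ ^ 2 * n) := by rw [hv]; ring
      _ ≤ p * q * (2 * (k + j - 1 - r)) := by gcongr
      _ = w := by rw [hw]; ring
  have hL : ((k + j + r) * (p * q)) ^ 2 ≤ ℓ ^ 2 * v ^ 2 := by
    calc _ ≤ (ℓ * n * (p * q)) ^ 2 := by gcongr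
      _ = _ := by rw [hv]; ring
  have hP : (j * p ^ 2) ^ 2 ≤ v ^ 3 * (1 / (n * q ^ 3)) := by
    have : v ^ 3 * (1 / (n * q ^ 3)) = (n * p) ^ 2 * p := by
      rw [hv]; field_simp
    rw [this]
    calc ((j : ℝ) * p ^ 2) ^ 2 ≤ (n * p ^ 2) ^ 2 := by gcongr
      _ = (n * p) ^ 2 * p * p := by ring
      _ ≤ _ := mul_le_of_le_one_right (by positivity) hp1
  set Q : ℝ := 1 / (n * q ^ 3) with hQ
  have hQ0 : 0 ≤ Q := by positivity
  have hπ : Real.pi ≤ 3.1416 := Real.pi_lt_d4.le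
  have hπ0 := Real.pi_pos
  have m0 := circleMoment_nonneg 0 w
  have m1 := circleMoment_nonneg 1 w
  have m2 := circleMoment_nonneg 2 w
  rcases le_total v (1 / 2) with hcase | hcase
  · refine le_trans ?_ (le_max_right _ _)
    refine (norm_mixProd_sq_le hG hp hq.le hpq hr hb hη k j hw).trans ?_
    have hw0 : 0 ≤ w := le_trans (by positivity) hwv
    have h0 := circleMoment_le_of_nonneg hw0 0
    have h1 := circleMoment_one_le_two hw0
    have h2 := circleMoment_le_of_nonneg hw0 2
    have hv2 : v ^ 2 ≤ (1 / 2) ^ 2 := by gcongr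
    have hv3 : v ^ 3 ≤ (1 / 2) ^ 3 := by gcongr
    have hL' : ((k + j + r) * (p * q)) ^ 2 ≤ ℓ ^ 2 * (1 / 2) ^ 2 := hL.trans (by gcongr)
    have hP' : (j * p ^ 2) ^ 2 ≤ (1 / 2) ^ 3 * Q := hP.trans (by gcongr)
    calc _ ≤ (1 + 3.1416 * b) * (4 ^ 0 + ((1 + η) * (ℓ ^ 2 * (1 / 2) ^ 2) * 2 +
          (1 + 1 / η) * ((1 / 2) ^ 3 * Q) * 4 ^ 2) / b ^ 2) := by gcongr
      _ = _ := by ring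
  · refine le_trans ?_ (le_max_left _ _)
    set V : ℝ := √v with hVdef
    have hVsq : V ^ 2 = v := Real.sq_sqrt hv0
    have hV : 0.7 ≤ V := Real.le_sqrt_of_sq_le (by norm_num; linarith)
    have hVpos : 0 < V := lt_of_lt_of_le (by norm_num) hV
    refine (norm_mixProd_sq_le hG hp hq.le hpq hr (b := β * V) (by positivity) hη k j hw).trans ?_
    obtain ⟨h0, h1, h2⟩ := circleMoment_scaled_le (w := w) (κ := κ) hVpos hκ (by
      rwa [mul_pow, hVsq])
    have hL' : ((k + j + r) * (p * q)) ^ 2 ≤ ℓ ^ 2 * V ^ 4 := hL.trans (by rw [← hVsq, ← pow_mul])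
    have hP' : (j * p ^ 2) ^ 2 ≤ V ^ 6 * Q := hP.trans (by rw [← hVsq, ← pow_mul])
    calc _ ≤ (1 + 3.1416 * (β * V)) * (0.6268 / κ / V +
          ((1 + η) * (ℓ ^ 2 * V ^ 4) * (0.6268 * 2.4675 / κ ^ 3 / V ^ 3) +
          (1 + 1 / η) * (V ^ 6 * Q) *
            (0.6268 * (3 * 2.4675 ^ 2) / κ ^ 5 / V ^ 5)) / (β * V) ^ 2) := by gcongr
      _ = (1 / V + 3.1416 * β) * (0.6268 / κ + ((1 + η) * ℓ ^ 2 * (0.6268 * 2.4675 / κ ^ 3) +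
          (1 + 1 / η) * (0.6268 * (3 * 2.4675 ^ 2) / κ ^ 5) * Q) / β ^ 2) := by
          field_simp
      _ ≤ _ := by gcongr

/-- Explicit bound for the product with `r = n / 2`. -/
theorem norm_mixProd_half_sq_le {G : 𝔸} (hG : ‖G‖ ≤ 1) {p q : ℝ} (hp : 0 ≤ p) (hq : 0 < q)
    (hpq : p + q = 1) {n k j : ℕ} (hn : 4000 ≤ n) (hkj : k + j + 1 = n) :
    ‖mixProd G p q (n / 2) k j‖ ^ 2 ≤ 12 + 400 * (1 / (n * q ^ 3)) := by
  have hnR : (4000 : ℝ) ≤ n := by exact_mod_cast hn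
  have hkjR : (k : ℝ) + j = n - 1 := by
    have : ((k + j + 1 : ℕ) : ℝ) = n := by rw [hkj]
    push_cast at this; linarith
  have hQ0 : 0 ≤ 1 / ((n : ℝ) * q ^ 3) := by positivity
  -- Here k + j + r < 1.5 n, and 2(k + j - 1 - r) = n - 4 exceeds 0.999² n for n ≥ 4000. With these
  -- β, η and b both entries of the maximum have constant term at most 12, just below 3.5².
  refine (norm_mixProd_sq_le_of_bounds hG hp hq hpq (r := n / 2) (by positivity) (n := n)
    (by omega) (by omega) (ℓ := 1.5) (κ := 0.999) (η := 1 / 20) (β := 2.36) (b := 3 / 2)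
    (by norm_num; linarith) (by norm_num) (by norm_num; linarith) (by norm_num) (by norm_num)
    (by norm_num)).trans (max_le ?_ ?_)
  · norm_num at hQ0 ⊢
    linarith
  · norm_num at hQ0 ⊢
    linarith

/-- Explicit bound for the product with `r = 3 n / 4`. -/
theorem norm_mixProd_three_quarters_sq_le {G : 𝔸} (hG : ‖G‖ ≤ 1) {p q : ℝ} (hp : 0 ≤ p)
    (hq : 0 < q) (hpq : p + q = 1) {n k j : ℕ} (hn : 4000 ≤ n) (hkj : k + j + 1 = n) :
    ‖mixProd G p q (3 * n / 4) k j‖ ^ 2 ≤ 1000 + 1000 * (1 / (n * q ^ 3)) := by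
  have hnR : (4000 : ℝ) ≤ n := by exact_mod_cast hn
  have hkjR : (k : ℝ) + j = n - 1 := by
    have : ((k + j + 1 : ℕ) : ℝ) = n := by rw [hkj]
    push_cast at this; linarith
  have hQ0 : 0 ≤ 1 / ((n : ℝ) * q ^ 3) := by positivity
  -- Now 2(k + j - 1 - r) = n/2 - 4, which exceeds 0.7² n. The constants are generous, because this
  -- bound only enters the error term.
  refine (norm_mixProd_sq_le_of_bounds hG hp hq hpq (r := 3 * n / 4) (by positivity) (n := n)
    (by omega) (by omega) (ℓ := 1.75) (κ := 0.7) (η := 1) (β := 1) (b := 1)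
    (by norm_num; linarith) (by norm_num) (by norm_num; linarith) (by norm_num) (by norm_num)
    (by norm_num)).trans (max_le ?_ ?_)
  · norm_num at hQ0 ⊢
    linarith
  · norm_num at hQ0 ⊢
    linarith

/-- Crude bound for the products when the exponents are bounded. -/
theorem norm_mixProd_le_exp {G : 𝔸} (hG : ‖G‖ ≤ 1) {p q r : ℝ} (hp : 0 ≤ p) (hq : 0 ≤ q)
    (hpq : p + q = 1) (hr : 0 ≤ r) (k j : ℕ) :
    ‖mixProd G p q r k j‖ ≤ Real.exp (4 * j + 2 * r) := by
  have hF : ‖q • (1 : 𝔸) + p • G‖ ≤ 1 := by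
    refine (norm_add_le _ _).trans ?_
    rw [norm_smul, norm_smul, norm_one, Real.norm_of_nonneg hp, Real.norm_of_nonneg hq]
    nlinarith
  have hu : ‖p • (G - 1)‖ ≤ 2 := by
    rw [norm_smul, Real.norm_of_nonneg hp]
    have : ‖G - 1‖ ≤ 2 := (norm_sub_le _ _).trans (by rw [norm_one]; linarith)
    nlinarith [norm_nonneg (G - 1)]
  have hu2 : ‖(p • (G - 1)) ^ 2‖ ≤ 4 := by
    refine (norm_pow_le _ 2).trans ?_
    nlinarith [norm_nonneg (p • (G - 1))]
  unfold mixProd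
  calc _ ≤ ‖q • (1 : 𝔸) + p • G‖ ^ k * Real.exp (4 * j + 2 * r) := by
        refine (norm_mul_le _ _).trans ?_
        gcongr
        · exact norm_pow_le _ _
        refine (norm_exp_le_real _).trans (Real.exp_le_exp.2 ?_)
        refine (norm_sub_le _ _).trans (add_le_add ?_ ?_)
        · rw [norm_smul, Real.norm_natCast, mul_comm]
          gcongr
          refine (norm_sub_le _ _).trans ?_
          rw [norm_smul (1 / 2 : ℝ), Real.norm_of_nonneg (by norm_num)]
          linarith
        · rw [norm_smul, Real.norm_of_nonneg (by positivity), mul_comm]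
          have : r * q ≤ r := mul_le_of_le_one_right hr (by linarith)
          gcongr
    _ ≤ 1 * Real.exp (4 * j + 2 * r) := by
        gcongr
        exact pow_le_one₀ (norm_nonneg _) hF
    _ = _ := one_mul _

end Norm

section Smoothing

variable {𝔸 : Type*} [NormedCommRing 𝔸] [NormedAlgebra ℝ 𝔸] [CompleteSpace 𝔸]

/-! ### Smoothing by Poisson exponentials -/

/-- The scalar factor exp(-c) cancels the growth exp ‖a‖: compound Poisson laws are contractions. -/
theorem norm_exp_sub_smul_one_le [NormOneClass 𝔸] {a : 𝔸} {c : ℝ} (h : ‖a‖ ≤ c) :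
    ‖NormedSpace.exp (a - c • 1)‖ ≤ 1 := by
  rw [sub_eq_add_neg, ← neg_smul, exp_add_real, exp_smul_one_real, mul_smul_comm, mul_one,
    norm_smul, Real.norm_of_nonneg (Real.exp_pos _).le]
  calc _ ≤ Real.exp (-c) * Real.exp c := by
        gcongr
        exact (norm_exp_le_real a).trans (Real.exp_le_exp.2 h)
    _ = 1 := by rw [← Real.exp_add, neg_add_cancel, Real.exp_zero]

theorem norm_exp_smul_sub_one_le [NormOneClass 𝔸] {S : 𝔸} (hS : ‖S‖ ≤ 1) {c : ℝ} (hc : 0 ≤ c) :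
    ‖NormedSpace.exp (c • (S - 1))‖ ≤ 1 := by
  rw [smul_sub]
  refine norm_exp_sub_smul_one_le ?_
  rw [norm_smul, Real.norm_of_nonneg hc]
  exact mul_le_of_le_one_right hc hS

theorem hasSum_natCast_mul_pow_div_factorial_smul (a : ℝ) (x : 𝔸) :
    HasSum (fun k : ℕ => ((k : ℝ) * (a ^ k / k.factorial)) • x ^ k)
      (a • x * NormedSpace.exp (a • x)) := by
  rw [← hasSum_nat_add_iff' 1]
  have h := (hasSum_pow_div_factorial_smul a x).mul_left (a • x)
  simp only [Finset.range_one, Finset.sum_singleton, Nat.cast_zero, zero_mul, zero_smul, sub_zero]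
  refine h.congr_fun fun k => ?_
  rw [smul_mul_smul_comm, ← pow_succ']
  congr 1
  rw [Nat.factorial_succ, pow_succ]
  have : (k.factorial : ℝ) ≠ 0 := by exact_mod_cast Nat.factorial_ne_zero k
  push_cast
  field_simp

theorem hasSum_sq_mul_pow_div_factorial (a : ℝ) :
    HasSum (fun k : ℕ => (k : ℝ) ^ 2 * (a ^ k / k.factorial)) ((a ^ 2 + a) * Real.exp a) := by
  rw [← hasSum_nat_add_iff' 1]
  have h1 := (hasSum_natCast_mul_pow_div_factorial_smul a (1 : ℝ)).mul_left a
  have h0 := (hasSum_pow_div_factorial_smul a (1 : ℝ)).mul_left a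
  simp only [smul_eq_mul, mul_one, one_pow, ← Real.exp_eq_exp_ℝ] at h0 h1
  have h := h1.add h0
  rw [show a * (a * Real.exp a) + a * Real.exp a = (a ^ 2 + a) * Real.exp a by ring] at h
  simp only [Finset.range_one, Finset.sum_singleton, Nat.cast_zero, ne_eq, OfNat.ofNat_ne_zero,
    not_false_eq_true, zero_pow, zero_mul, sub_zero]
  refine h.congr_fun fun k => ?_
  rw [Nat.factorial_succ, pow_succ]
  have : (k.factorial : ℝ) ≠ 0 := by exact_mod_cast Nat.factorial_ne_zero k
  push_cast
  field_simp
  ring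

/-- The element is the mean of (N/c - 1) S^N for N Poisson with mean c. Its norm is at most the mean
of |N/c - 1|, and |x| ≤ (√c x² + 1/√c)/2 with N/c of variance 1/c gives 1/√c. -/
theorem norm_sub_one_mul_exp_le [NormOneClass 𝔸] {S : 𝔸} (hS : ‖S‖ ≤ 1) {c : ℝ} (hc : 0 < c) :
    ‖(S - 1) * NormedSpace.exp (c • (S - 1))‖ ≤ 1 / √c := by
  have hr : 0 < √c := Real.sqrt_pos.2 hc
  have hr2 : √c ^ 2 = c := Real.sq_sqrt hc.le
  have hS1 := (hasSum_natCast_mul_pow_div_factorial_smul c S).const_smul (Real.exp (-c) / c)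
  have hS0 := (hasSum_pow_div_factorial_smul c S).const_smul (Real.exp (-c))
  have hexp : NormedSpace.exp (c • (S - 1)) = Real.exp (-c) • NormedSpace.exp (c • S) := by
    rw [smul_sub, sub_eq_add_neg, ← neg_smul, exp_add_real, exp_smul_one_real, mul_smul_comm,
      mul_one]
  have hsum := hS1.sub hS0
  have hval : (Real.exp (-c) / c) • (c • S * NormedSpace.exp (c • S)) -
      Real.exp (-c) • NormedSpace.exp (c • S) = (S - 1) * NormedSpace.exp (c • (S - 1)) := by
    rw [hexp, smul_mul_assoc, smul_smul, div_mul_cancel₀ _ hc.ne', mul_smul_comm, sub_mul, one_mul,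
      smul_sub]
  rw [hval] at hsum
  have r0 := hasSum_pow_div_factorial_smul c (1 : ℝ)
  have r1 := hasSum_natCast_mul_pow_div_factorial_smul c (1 : ℝ)
  have r2 := hasSum_sq_mul_pow_div_factorial c
  simp only [smul_eq_mul, mul_one, one_pow, ← Real.exp_eq_exp_ℝ] at r0 r1
  have hbound := (((r2.mul_left (1 / c ^ 2)).sub (r1.mul_left (2 / c))).add r0).mul_left
    (√c / 2 * Real.exp (-c)) |>.add (r0.mul_left (1 / √c / 2 * Real.exp (-c)))
  have hbv : √c / 2 * Real.exp (-c) * (1 / c ^ 2 * ((c ^ 2 + c) * Real.exp c) -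
      2 / c * (c * Real.exp c) + Real.exp c) + 1 / √c / 2 * Real.exp (-c) * Real.exp c = 1 / √c := by
    have he : Real.exp (-c) * Real.exp c = 1 := by rw [← Real.exp_add, neg_add_cancel, Real.exp_zero]
    calc _ = (Real.exp (-c) * Real.exp c) * (√c / (2 * c) + 1 / √c / 2) := by field_simp; ring
      _ = _ := by
        rw [he]
        nth_rewrite 2 [← hr2]
        field_simp
        norm_num
  rw [hbv] at hbound
  rw [← hsum.tsum_eq]
  refine tsum_of_norm_bounded hbound fun k => ?_
  have hP : 0 ≤ c ^ k / k.factorial := by positivity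
  set P := c ^ k / (k.factorial : ℝ)
  rw [smul_smul, smul_smul, ← sub_smul]
  refine (norm_smul_pow_le hS _ k).trans ?_
  have e1 : Real.exp (-c) / c * (k * P) - Real.exp (-c) * P = Real.exp (-c) * P * (k / c - 1) := by
    field_simp
  have e2 : √c / 2 * Real.exp (-c) * (1 / c ^ 2 * ((k : ℝ) ^ 2 * P) - 2 / c * (k * P) + P) +
      1 / √c / 2 * Real.exp (-c) * P =
      Real.exp (-c) * P * (√c / 2 * (k / c - 1) ^ 2 + 1 / √c / 2) := by
    field_simp
    ring
  rw [e1, e2, abs_mul, abs_of_nonneg (by positivity)]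
  gcongr
  have h3 : 0 ≤ (√c * |(k : ℝ) / c - 1| - 1) ^ 2 / (2 * √c) := by positivity
  have h4 : √c / 2 * ((k : ℝ) / c - 1) ^ 2 + 1 / √c / 2 - |(k : ℝ) / c - 1| =
      (√c * |(k : ℝ) / c - 1| - 1) ^ 2 / (2 * √c) := by
    rw [← sq_abs ((k : ℝ) / c - 1)]
    field_simp
    ring
  linarith

/-- The second difference smoothed by the exponential of its own generator. -/
theorem norm_mul_sub_one_mul_exp_le [NormOneClass 𝔸] {S S' : 𝔸} (hS : ‖S‖ ≤ 1) (hS' : ‖S'‖ ≤ 1)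
    {c : ℝ} (hc : 0 ≤ c) :
    c * ‖(S - 1) * NormedSpace.exp (c • (S - 1)) * ((S' - 1) * NormedSpace.exp (c • (S' - 1)))‖ ≤
      4 / Real.exp 1 * min 1 (Real.exp 1 * c) := by
  have he : 0 < Real.exp 1 := Real.exp_pos 1
  have he4 : 1 ≤ 4 / Real.exp 1 := by
    rw [one_le_div he]
    have := Real.exp_one_lt_d9
    linarith
  have h2 : ∀ {T : 𝔸}, ‖T‖ ≤ 1 → ‖(T - 1) * NormedSpace.exp (c • (T - 1))‖ ≤ 2 := by
    intro T hT
    have h3 : ‖T - 1‖ ≤ 2 := (norm_sub_le _ _).trans (by rw [norm_one]; linarith)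
    refine (norm_mul_le _ _).trans ?_
    have := norm_exp_smul_sub_one_le hT hc
    calc _ ≤ (2 : ℝ) * 1 := by gcongr
      _ = 2 := mul_one _
  -- For the first entry the smoothing bound 1/√c is used twice, giving 1 ≤ 4/e; for the second,
  -- each factor has norm at most 2, giving 4c.
  rw [mul_min_of_nonneg _ _ (by positivity)]
  refine le_min ?_ ?_
  · rcases hc.eq_or_lt with rfl | hc
    · rw [zero_mul, mul_one]; positivity
    refine le_trans ?_ ((mul_one (4 / Real.exp 1)).symm ▸ he4)
    have hr : 0 < √c := Real.sqrt_pos.2 hc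
    calc _ ≤ c * (1 / √c * (1 / √c)) := by
          gcongr
          refine (norm_mul_le _ _).trans ?_
          gcongr
          · exact norm_sub_one_mul_exp_le hS hc
          · exact norm_sub_one_mul_exp_le hS' hc
      _ = 1 := by
          rw [one_div_mul_one_div, Real.mul_self_sqrt hc.le, mul_one_div_cancel hc.ne']
  · calc _ ≤ c * (2 * 2) := by
          gcongr
          refine (norm_mul_le _ _).trans ?_
          gcongr
          · exact h2 hS
          · exact h2 hS'
      _ = 4 / Real.exp 1 * (Real.exp 1 * c) := by field_simp; norm_num

end Smoothing

/-! ### Symmetric mixtures of shifts -/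

theorem norm_le_of_hasSum_smul {𝔸 Λ : Type*} [NormedCommRing 𝔸] [NormedAlgebra ℝ 𝔸] {S : Λ → 𝔸}
    (hSn : ∀ x, ‖S x‖ ≤ 1) {f : Λ → ℝ} (hf : ∀ x, 0 ≤ f x) {a : ℝ} (hfa : HasSum f a) {T : 𝔸} (hT : HasSum (fun x => f x • S x) T) : ‖T‖ ≤ a := by
  rw [← hT.tsum_eq]
  refine tsum_of_norm_bounded hfa fun x => ?_
  rw [norm_smul, Real.norm_of_nonneg (hf x)]
  exact mul_le_of_le_one_right (hf x) (hSn x)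

section Mixture

variable {𝔸 : Type*} [NormedCommRing 𝔸] [NormedAlgebra ℝ 𝔸] [NormOneClass 𝔸] [CompleteSpace 𝔸]
  {Λ : Type*} [AddCommGroup Λ]

/-- By symmetry, and since S x and S (-x) are inverse, T - 1 = -(1/2) ∑ f x (S x - 1)(S (-x) - 1).
Each second difference takes from exp(s(T - 1)) the two factors generated by x and -x with intensity
c = s f x; what is left is a contraction. The single bound (4/e) min(1, ec) is then summed over x ≠
0. -/
theorem norm_generator_mul_exp_le {S : Λ → 𝔸} (hSadd : ∀ x y, S (x + y) = S x * S y)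
    (hS0 : S 0 = 1) (hSn : ∀ x, ‖S x‖ ≤ 1) (htor : ∀ x : Λ, x ≠ 0 → x ≠ -x) {f : Λ → ℝ}
    (hf : ∀ x, 0 ≤ f x) (hf1 : HasSum f 1) (hsymm : ∀ x, f (-x) = f x) {T : 𝔸}
    (hT : HasSum (fun x => f x • S x) T) {s : ℝ} (hs : 0 < s) :
    ‖(T - 1) * NormedSpace.exp (s • (T - 1))‖ ≤
      2 / (Real.exp 1 * s) * ∑' x : {x : Λ // x ≠ 0}, min 1 (s * Real.exp 1 * f x) := by
  classical
  set u : 𝔸 := T - 1 with hu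
  set X : 𝔸 := NormedSpace.exp (s • u) with hX
  have hu1 : HasSum (fun x => f x • (S x - 1)) u := by
    have := hT.sub (hf1.smul_const (1 : 𝔸))
    rw [one_smul] at this
    exact this.congr_fun fun x => smul_sub _ _ _
  have hu2 : HasSum (fun x => f x • (S (-x) - 1)) u := by
    rw [← (Equiv.neg Λ).hasSum_iff]
    refine hu1.congr_fun fun x => ?_
    simp [hsymm]
  have hterm : ∀ x, (1 / 2 : ℝ) • (f x • (S x - 1) + f x • (S (-x) - 1)) =
      (-(1 / 2) * f x) • ((S x - 1) * (S (-x) - 1)) := by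
    intro x
    have h1 : S x * S (-x) = 1 := by rw [← hSadd, add_neg_cancel, hS0]
    have h2 : (S x - 1) * (S (-x) - 1) = -((S x - 1) + (S (-x) - 1)) := by
      linear_combination h1
    rw [h2]
    module
  have hu3 : HasSum (fun x => (-(1 / 2) * f x) • ((S x - 1) * (S (-x) - 1))) u := by
    have := (hu1.add hu2).const_smul (1 / 2 : ℝ)
    rw [show (1 / 2 : ℝ) • (u + u) = u by module] at this
    exact this.congr_fun fun x => (hterm x).symm
  have hu4 := hu3.mul_right X
  have hmin : ∀ x, 0 ≤ min 1 (s * Real.exp 1 * f x) := fun x =>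
    le_min zero_le_one (mul_nonneg (by positivity) (hf x))
  have hδ : Summable (fun x => Set.indicator {x : Λ | x ≠ 0}
      (fun x => min 1 (s * Real.exp 1 * f x)) x) := by
    refine Summable.of_nonneg_of_le (fun x => Set.indicator_nonneg (fun y _ => hmin y) x) (fun x => ?_)
      (hf1.summable.mul_left (s * Real.exp 1))
    exact (Set.indicator_le_self' (fun y _ => hmin y) x).trans (min_le_right _ _)
  have hbd : ∀ x, ‖(-(1 / 2) * f x) • ((S x - 1) * (S (-x) - 1)) * X‖ ≤
      2 / (Real.exp 1 * s) * Set.indicator {x : Λ | x ≠ 0}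
        (fun x => min 1 (s * Real.exp 1 * f x)) x := by
    intro x
    by_cases hx : x = 0
    · subst hx
      simp [hS0]
    rw [Set.indicator_of_mem (by exact hx)]
    have hxn := htor x hx
    set c := s * f x with hc
    have hc0 : 0 ≤ c := mul_nonneg hs.le (hf x)
    -- Removing the masses at x and -x leaves nonnegative weights of total 1 - 2 f x. The points x
    -- and -x must differ, otherwise the same mass would be removed twice.
    have hrest : ‖NormedSpace.exp (s • (u - f x • (S x - 1) - f x • (S (-x) - 1)))‖ ≤ 1 := by
      have h1 : HasSum (fun y => f y - (if y = x then f x else 0) - (if y = -x then f x else 0))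
          (1 - f x - f x) := (hf1.sub (hasSum_ite_eq x (f x))).sub (hasSum_ite_eq (-x) (f x))
      have h2 : HasSum (fun y => (f y - (if y = x then f x else 0) -
          (if y = -x then f x else 0)) • S y) (T - f x • S x - f x • S (-x)) := by
        refine ((hT.sub (hasSum_ite_eq x (f x • S x))).sub
          (hasSum_ite_eq (-x) (f x • S (-x)))).congr_fun fun y => ?_
        by_cases h3 : y = x
        · subst h3
          rw [if_pos rfl, if_neg hxn, if_pos rfl, if_neg hxn]
          module
        · by_cases h4 : y = -x
          · subst h4
            rw [if_neg h3, if_pos rfl, if_neg h3, if_pos rfl]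
            module
          · rw [if_neg h3, if_neg h4, if_neg h3, if_neg h4]
            module
      have hn := norm_le_of_hasSum_smul hSn (fun y => ?_) h1 h2
      · have e : s • (u - f x • (S x - 1) - f x • (S (-x) - 1)) =
            s • (T - f x • S x - f x • S (-x)) - (s * (1 - f x - f x)) • (1 : 𝔸) := by
          rw [hu]
          module
        rw [e]
        refine norm_exp_sub_smul_one_le ?_
        rw [norm_smul, Real.norm_of_nonneg hs.le]
        gcongr
      · by_cases h3 : y = x
        · subst h3
          rw [if_pos rfl, if_neg hxn]
          simp
        · by_cases h4 : y = -x
          · subst h4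
            rw [if_neg h3, if_pos rfl, hsymm]
            simp
          · rw [if_neg h3, if_neg h4]
            simpa using hf y
    have hXs : X = NormedSpace.exp (c • (S x - 1)) * NormedSpace.exp (c • (S (-x) - 1)) *
        NormedSpace.exp (s • (u - f x • (S x - 1) - f x • (S (-x) - 1))) := by
      rw [← exp_add_real, ← exp_add_real, hX, hc]
      congr 1
      module
    have e : (-(1 / 2) * f x) • ((S x - 1) * (S (-x) - 1)) * X =
        (-(1 / (2 * s)) * c) • ((S x - 1) * NormedSpace.exp (c • (S x - 1)) *
          ((S (-x) - 1) * NormedSpace.exp (c • (S (-x) - 1))) *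
          NormedSpace.exp (s • (u - f x • (S x - 1) - f x • (S (-x) - 1)))) := by
      rw [hXs, smul_mul_assoc]
      congr 1
      · rw [hc]; field_simp
      · ring
    have hk := norm_mul_sub_one_mul_exp_le (hSn x) (hSn (-x)) hc0
    rw [e, norm_smul, norm_mul, norm_neg, Real.norm_of_nonneg hc0,
      Real.norm_of_nonneg (by positivity)]
    calc _ ≤ 1 / (2 * s) * c * (‖(S x - 1) * NormedSpace.exp (c • (S x - 1)) *
          ((S (-x) - 1) * NormedSpace.exp (c • (S (-x) - 1)))‖ * 1) := by
          gcongr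
          refine (norm_mul_le _ _).trans ?_
          gcongr
      _ = 1 / (2 * s) * (c * ‖(S x - 1) * NormedSpace.exp (c • (S x - 1)) *
          ((S (-x) - 1) * NormedSpace.exp (c • (S (-x) - 1)))‖) := by ring
      _ ≤ 1 / (2 * s) * (4 / Real.exp 1 * min 1 (Real.exp 1 * c)) := by gcongr
      _ = _ := by
          rw [hc, show Real.exp 1 * (s * f x) = s * Real.exp 1 * f x by ring]
          field_simp
          norm_num
  rw [← hu4.tsum_eq]
  refine (tsum_of_norm_bounded (hδ.mul_left _).hasSum hbd).trans (le_of_eq ?_)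
  rw [tsum_mul_left]
  congr 1
  exact (tsum_subtype {x : Λ | x ≠ 0} fun x => min 1 (s * Real.exp 1 * f x)).symm

end Mixture

section Expansion

variable {𝔸 : Type*} [NormedCommRing 𝔸] [NormedAlgebra ℝ 𝔸] [NormOneClass 𝔸] [CompleteSpace 𝔸]

/-! ### Expansion of `1 + u - exp (u - u ^ 2 / 2)` -/

/-- In the Taylor expansion of exp(u - u²/2) the terms in u² cancel and u³ keeps the coefficient
-1/2 + 1/6 = -1/3. All later terms contain u⁴. -/
theorem exists_one_add_sub_exp_eq {u : 𝔸} (hu : ‖u‖ ≤ 2) :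
    ∃ K : 𝔸, ‖K‖ ≤ 1 + 16 * Real.exp 4 ∧
      1 + u - NormedSpace.exp (u - (1 / 2 : ℝ) • u ^ 2) = (1 / 3 : ℝ) • u ^ 3 + u ^ 4 * K := by
  obtain ⟨R, hR, hexp⟩ := exists_exp_eq_taylor (u - (1 / 2 : ℝ) • u ^ 2)
  have hu2 : ‖u ^ 2‖ ≤ 4 := (norm_pow_le _ 2).trans (by nlinarith [norm_nonneg u])
  have hhalf : ∀ {c : ℝ} (x : 𝔸), 0 ≤ c → ‖c • x‖ = c * ‖x‖ := fun x hc => by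
    rw [norm_smul, Real.norm_of_nonneg hc]
  have hy : ‖u - (1 / 2 : ℝ) • u ^ 2‖ ≤ 4 := by
    refine (norm_sub_le _ _).trans ?_
    rw [hhalf _ (by norm_num)]
    linarith
  have hR' : ‖R‖ ≤ Real.exp 4 := hR.trans (Real.exp_le_exp.2 hy)
  refine ⟨(1 / 8 : ℝ) • 1 - (1 / 8 : ℝ) • u + (1 / 48 : ℝ) • u ^ 2 -
    (1 - (1 / 2 : ℝ) • u) ^ 4 * R, ?_, ?_⟩
  · have h1 : ‖(1 - (1 / 2 : ℝ) • u) ^ 4 * R‖ ≤ 16 * Real.exp 4 := by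
      have : ‖1 - (1 / 2 : ℝ) • u‖ ≤ 2 := by
        refine (norm_sub_le _ _).trans ?_
        rw [hhalf _ (by norm_num), norm_one]
        linarith
      refine (norm_mul_le _ _).trans ?_
      calc _ ≤ (2 : ℝ) ^ 4 * Real.exp 4 := by
            gcongr
            exact (norm_pow_le _ 4).trans (by gcongr)
        _ = _ := by norm_num
    refine (norm_sub_le _ _).trans (add_le_add ?_ h1)
    refine (norm_add_le _ _).trans ?_
    have h2 := norm_sub_le ((1 / 8 : ℝ) • (1 : 𝔸)) ((1 / 8 : ℝ) • u)
    rw [hhalf _ (by norm_num), hhalf _ (by norm_num), norm_one] at h2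
    rw [hhalf _ (by norm_num)]
    linarith
  · rw [hexp]
    -- All scalars are multiples of 1/48. With the single relation 48ε = 1 the claim becomes a
    -- polynomial identity in the ring.
    set ε : 𝔸 := algebraMap ℝ 𝔸 (1 / 48) with hε
    have h48 : 48 * ε = 1 := by
      rw [hε, ← map_ofNat (algebraMap ℝ 𝔸) 48, ← map_mul]
      norm_num
    have hc : ∀ m : ℕ, algebraMap ℝ 𝔸 (m * (1 / 48)) = m * ε := fun m => by
      rw [map_mul, map_natCast]
    have e2 : algebraMap ℝ 𝔸 (1 / 2) = 24 * ε := by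
      rw [← Nat.cast_ofNat (R := 𝔸), ← hc]; congr 1; norm_num
    have e3 : algebraMap ℝ 𝔸 (1 / 3) = 16 * ε := by
      rw [← Nat.cast_ofNat (R := 𝔸), ← hc]; congr 1; norm_num
    have e6 : algebraMap ℝ 𝔸 (1 / 6) = 8 * ε := by
      rw [← Nat.cast_ofNat (R := 𝔸), ← hc]; congr 1; norm_num
    have e8 : algebraMap ℝ 𝔸 (1 / 8) = 6 * ε := by
      rw [← Nat.cast_ofNat (R := 𝔸), ← hc]; congr 1; norm_num
    simp only [Algebra.smul_def, e2, e3, e6, e8, ← hε]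
    linear_combination (24 * ε * u ^ 3 - 6 * ε * (48 * ε - 1) * u ^ 4 -
      6 * ε * (48 * ε + 1) * u ^ 5 + ε * ((48 * ε) ^ 2 + 48 * ε + 1) * u ^ 6) * h48

/-- The difference of powers is a multiple of the generator. -/
theorem exists_pow_sub_exp_pow_eq_mul {u : 𝔸} (hu : ‖u‖ ≤ 2) (n : ℕ) :
    ∃ y : 𝔸, (1 + u) ^ n - NormedSpace.exp (u - (1 / 2 : ℝ) • u ^ 2) ^ n = u * y := by
  obtain ⟨K, -, hK⟩ := exists_one_add_sub_exp_eq hu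
  refine ⟨((1 / 3 : ℝ) • u ^ 2 + u ^ 3 * K) * ∑ i ∈ Finset.range n,
    (1 + u) ^ i * NormedSpace.exp (u - (1 / 2 : ℝ) • u ^ 2) ^ (n - 1 - i), ?_⟩
  rw [← geom_sum₂_mul, hK, Algebra.smul_def (1 / 3 : ℝ) (u ^ 3), Algebra.smul_def (1 / 3 : ℝ) (u ^ 2)]
  ring

/-! ### Numerical bounds for the smoothed factors -/

/-- For large n this is a square root of the explicit bound, as 12 < 3.5² and 400 < 64². For n <
4000 the crude exponential bound is charged wholly to the error term: n < 64² and q ≤ 1 force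
√(1/(nq³)) ≥ 1/64. Thus the leading constant 3.5 holds for every n. -/
theorem norm_mixProd_half_le {G : 𝔸} (hG : ‖G‖ ≤ 1) {p q : ℝ} (hp : 0 ≤ p) (hq : 0 < q)
    (hpq : p + q = 1) {n k j : ℕ} (hkj : k + j + 1 = n) :
    ‖mixProd G p q (n / 2) k j‖ ≤ 3.5 + 64 * Real.exp 20000 * √(1 / (n * q ^ 3)) := by
  have hn0 : (0 : ℝ) < n := by exact_mod_cast (by omega : 0 < n)
  have hY0 : 0 ≤ √(1 / ((n : ℝ) * q ^ 3)) := Real.sqrt_nonneg _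
  have hY2 : √(1 / ((n : ℝ) * q ^ 3)) ^ 2 = 1 / (n * q ^ 3) := Real.sq_sqrt (by positivity)
  rcases le_or_gt 4000 n with hn | hn
  · have h := norm_mixProd_half_sq_le hG hp hq hpq hn hkj
    rw [← hY2] at h
    have he : 1 ≤ Real.exp 20000 := Real.one_le_exp (by norm_num)
    set Y := √(1 / ((n : ℝ) * q ^ 3))
    refine abs_le_of_sq_le_sq' (h.trans ?_) (by positivity) |>.2
    have h1 : 64 * Y ≤ 64 * Real.exp 20000 * Y := by nlinarith
    calc 12 + 400 * Y ^ 2 ≤ (3.5 + 64 * Y) ^ 2 := by norm_num; nlinarith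
      _ ≤ _ := by gcongr
  · have hnR : (n : ℝ) ≤ 4000 := by exact_mod_cast hn.le
    have hjn : (j : ℝ) ≤ n := by exact_mod_cast (by omega : j ≤ n)
    refine (norm_mixProd_le_exp hG hp hq.le hpq (by positivity) k j).trans ?_
    have h1 : 1 / 64 ≤ √(1 / ((n : ℝ) * q ^ 3)) := by
      refine Real.le_sqrt_of_sq_le ?_
      rw [div_pow, one_pow]
      refine one_div_le_one_div_of_le (by positivity) ?_
      have : q ^ 3 ≤ 1 := pow_le_one₀ hq.le (by linarith)
      nlinarith
    calc Real.exp (4 * j + 2 * (n / 2)) ≤ Real.exp 20000 := Real.exp_le_exp.2 (by linarith)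
      _ = 64 * Real.exp 20000 * (1 / 64) := by ring
      _ ≤ 64 * Real.exp 20000 * √(1 / ((n : ℝ) * q ^ 3)) := by gcongr
      _ ≤ _ := by norm_num

theorem norm_mixProd_three_quarters_le {G : 𝔸} (hG : ‖G‖ ≤ 1) {p q : ℝ} (hp : 0 ≤ p) (hq : 0 < q)
    (hpq : p + q = 1) {n k j : ℕ} (hkj : k + j + 1 = n) :
    ‖mixProd G p q (3 * n / 4) k j‖ ≤ 32 * Real.exp 22000 * (1 + √(1 / (n * q ^ 3))) := by
  have hn0 : (0 : ℝ) < n := by exact_mod_cast (by omega : 0 < n)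
  have hY0 : 0 ≤ √(1 / ((n : ℝ) * q ^ 3)) := Real.sqrt_nonneg _
  have hY2 : √(1 / ((n : ℝ) * q ^ 3)) ^ 2 = 1 / (n * q ^ 3) := Real.sq_sqrt (by positivity)
  have he : 1 ≤ Real.exp 22000 := Real.one_le_exp (by norm_num)
  rcases le_or_gt 4000 n with hn | hn
  · have h := norm_mixProd_three_quarters_sq_le hG hp hq hpq hn hkj
    rw [← hY2] at h
    set Y := √(1 / ((n : ℝ) * q ^ 3))
    refine abs_le_of_sq_le_sq' (h.trans ?_) (by positivity) |>.2
    have h1 : 32 * (1 + Y) ≤ 32 * Real.exp 22000 * (1 + Y) := by nlinarith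
    calc 1000 + 1000 * Y ^ 2 ≤ (32 * (1 + Y)) ^ 2 := by nlinarith
      _ ≤ _ := by gcongr
  · have hnR : (n : ℝ) ≤ 4000 := by exact_mod_cast hn.le
    have hjn : (j : ℝ) ≤ n := by exact_mod_cast (by omega : j ≤ n)
    refine (norm_mixProd_le_exp hG hp hq.le hpq (by positivity) k j).trans ?_
    have h2 : Real.exp (4 * j + 2 * (3 * n / 4)) ≤ Real.exp 22000 := Real.exp_le_exp.2 (by linarith)
    nlinarith

/-- The constant of the final estimate. -/
noncomputable def errConst : ℝ :=
  64 * Real.exp 20000 + 3 * ((1 + 16 * Real.exp 4) * (2 * (32 * Real.exp 22000 * 2)))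

theorem errConst_pos : 0 < errConst := by unfold errConst; positivity

/-- The bound for one summand of the telescoping sum, given the smoothing bound `t`. -/
theorem norm_telescope_term_le {G : 𝔸} (hG : ‖G‖ ≤ 1) {p q : ℝ} (hp : 0 < p) (hq : 0 < q)
    (hpq : p + q = 1) {n k j : ℕ} (hkj : k + j + 1 = n) {u : 𝔸} (hu : u = p • (G - 1)) {t : ℝ}
    (ht : ‖u * NormedSpace.exp ((n * q / 6) • u)‖ ≤ t) :
    ‖(1 + u) ^ k * NormedSpace.exp (u - (1 / 2 : ℝ) • u ^ 2) ^ j *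
      (1 + u - NormedSpace.exp (u - (1 / 2 : ℝ) • u ^ 2))‖ ≤
      t ^ 3 * (3.5 / 3 * (1 + errConst / (q ^ (7 / 2 : ℝ) * √n))) := by
  have hn0 : (0 : ℝ) < n := by exact_mod_cast (by omega : 0 < n)
  have hn1 : (1 : ℝ) ≤ n := by exact_mod_cast (by omega : 1 ≤ n)
  have hq1 : q ≤ 1 := by linarith
  have ht0 : 0 ≤ t := (norm_nonneg _).trans ht
  have hu2 : ‖u‖ ≤ 2 := by
    rw [hu, norm_smul, Real.norm_of_nonneg hp.le]
    have : ‖G - 1‖ ≤ 2 := (norm_sub_le _ _).trans (by rw [norm_one]; linarith)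
    nlinarith [norm_nonneg (G - 1)]
  obtain ⟨K, hK, hD⟩ := exists_one_add_sub_exp_eq hu2
  set E : 𝔸 := NormedSpace.exp ((n * q / 6) • u) with hE
  set E' : 𝔸 := NormedSpace.exp ((n * q / 4) • u) with hE'
  have hF : q • (1 : 𝔸) + p • G = 1 + u := by
    rw [hu, show q = 1 - p by linarith]
    module
  -- Since `mixProd` contains exp(-rqu), multiplying by exp(rqu) restores F^k D^j for every r. The
  -- choices r = n/2 and r = 3n/4 serve the terms u³/3 and u⁴K respectively.
  have hfac : ∀ r : ℝ, mixProd G p q r k j * NormedSpace.exp ((r * q) • u) =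
      (1 + u) ^ k * NormedSpace.exp (u - (1 / 2 : ℝ) • u ^ 2) ^ j := by
    intro r
    rw [mixProd, hF, ← hu, mul_assoc, ← exp_add_real, sub_add_cancel, exp_natCast_smul_real]
  have hE3 : NormedSpace.exp ((n / 2 * q : ℝ) • u) = E ^ 3 := by
    rw [hE, ← exp_natCast_smul_real]
    congr 1
    module
  have hE4 : NormedSpace.exp ((3 * n / 4 * q : ℝ) • u) = E ^ 3 * E' := by
    rw [← hE3, hE', ← exp_add_real]
    congr 1
    module
  have h1 := hfac (n / 2)
  have h2 := hfac (3 * n / 4)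
  rw [hE3] at h1
  rw [hE4] at h2
  have hdecomp : (1 + u) ^ k * NormedSpace.exp (u - (1 / 2 : ℝ) • u ^ 2) ^ j *
      (1 + u - NormedSpace.exp (u - (1 / 2 : ℝ) • u ^ 2)) =
      (u * E) ^ 3 * ((1 / 3 : ℝ) • mixProd G p q (n / 2) k j +
        K * ((u * E') * mixProd G p q (3 * n / 4) k j)) := by
    rw [hD, mul_add, mul_add]
    congr 1
    · rw [← h1, mul_smul_comm, mul_smul_comm]
      congr 1
      ring
    · rw [← h2]
      ring
  -- The fourth u is smoothed by the plain Poisson bound, without symmetry. The factor √p that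
  -- remains is at most 1.
  have hE'n : ‖u * E'‖ ≤ 2 / √(n * q) := by
    have hc : 0 < n * q / 4 * p := by positivity
    have h3 := norm_sub_one_mul_exp_le hG hc
    have e : u * E' = p • ((G - 1) * NormedSpace.exp ((n * q / 4 * p) • (G - 1))) := by
      rw [hE', hu, smul_smul, smul_mul_assoc]
    rw [e, norm_smul, Real.norm_of_nonneg hp.le]
    have hsp : √p ^ 2 = p := Real.sq_sqrt hp.le
    have hsp0 : 0 < √p := Real.sqrt_pos.2 hp
    have hsp1 : √p ≤ 1 := Real.sqrt_le_one.2 (by linarith)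
    have hs0 : 0 < √(n * q) := Real.sqrt_pos.2 (by positivity)
    have es : √(n * q / 4 * p) = √(n * q) / 2 * √p := by
      rw [Real.sqrt_mul (by positivity), Real.sqrt_div (by positivity),
        show (4 : ℝ) = 2 ^ 2 by norm_num, Real.sqrt_sq (by norm_num)]
    calc _ ≤ p * (1 / √(n * q / 4 * p)) := by gcongr
      _ = √p * (2 / √(n * q)) := by
          rw [es]
          nth_rewrite 1 [← hsp]
          field_simp
      _ ≤ _ := mul_le_of_le_one_left (by positivity) hsp1
  set Z : ℝ := 1 / (q ^ (7 / 2 : ℝ) * √n) with hZ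
  have hsn : 0 < √(n : ℝ) := Real.sqrt_pos.2 hn0
  have hsn1 : 1 ≤ √(n : ℝ) := Real.one_le_sqrt.2 hn1
  have hsq : 0 < √q := Real.sqrt_pos.2 hq
  have hsq2 : √q ^ 2 = q := Real.sq_sqrt hq.le
  have hsq1 : √q ≤ 1 := Real.sqrt_le_one.2 hq1
  have hq7 : q ^ (7 / 2 : ℝ) = √q ^ 7 := by
    rw [Real.sqrt_eq_rpow, ← Real.rpow_natCast, ← Real.rpow_mul hq.le]
    norm_num
  have hY : √(1 / ((n : ℝ) * q ^ 3)) = 1 / (√q ^ 3 * √n) := by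
    rw [Real.sqrt_div zero_le_one, Real.sqrt_one, Real.sqrt_mul hn0.le, mul_comm]
    congr 2
    rw [show q ^ 3 = (√q ^ 3) ^ 2 by rw [← pow_mul, mul_comm, pow_mul, hsq2],
      Real.sqrt_sq (by positivity)]
  have hpow : ∀ m, m ≤ 7 → √q ^ 7 ≤ √q ^ m := fun m hm => pow_le_pow_of_le_one hsq.le hsq1 hm
  have hYZ : √(1 / ((n : ℝ) * q ^ 3)) ≤ Z := by
    rw [hY, hZ, hq7]
    exact one_div_le_one_div_of_le (by positivity)
      (mul_le_mul_of_nonneg_right (hpow 3 (by norm_num)) hsn.le)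
  -- The product only costs √q to the power -4; the higher power -7 in Z is a weakening allowed by q
  -- ≤ 1.
  have hprod : 1 / √(n * q) * (1 + √(1 / ((n : ℝ) * q ^ 3))) ≤ 2 * Z := by
    have h5 : √(1 / ((n : ℝ) * q ^ 3)) ≤ 1 / √q ^ 3 := by
      rw [hY]
      gcongr
      exact le_mul_of_one_le_right (by positivity) hsn1
    have h6 : 1 ≤ 1 / √q ^ 3 := by
      rw [one_le_div (by positivity)]
      exact pow_le_one₀ hsq.le hsq1
    calc _ ≤ 1 / (√n * √q) * (1 / √q ^ 3 + 1 / √q ^ 3) := by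
          rw [Real.sqrt_mul hn0.le]
          gcongr
      _ = 2 * (1 / (√q ^ 4 * √n)) := by field_simp; norm_num
      _ ≤ 2 * Z := by
          rw [hZ, hq7]
          refine mul_le_mul_of_nonneg_left ?_ zero_le_two
          exact one_div_le_one_div_of_le (by positivity)
            (mul_le_mul_of_nonneg_right (hpow 4 (by norm_num)) hsn.le)
  have hZ0 : 0 ≤ Z := by rw [hZ, hq7]; positivity
  have ha := norm_mixProd_half_le hG hp.le hq hpq hkj
  have hb := norm_mixProd_three_quarters_le hG hp.le hq hpq hkj
  rw [hdecomp]
  refine (norm_mul_le _ _).trans ?_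
  refine mul_le_mul ((norm_pow_le _ 3).trans (by gcongr)) ?_ (norm_nonneg _) (by positivity)
  have hA : ‖(1 / 3 : ℝ) • mixProd G p q (n / 2) k j‖ ≤
      1 / 3 * (3.5 + 64 * Real.exp 20000 * Z) := by
    rw [norm_smul, Real.norm_of_nonneg (by norm_num)]
    gcongr
    exact ha.trans (by gcongr)
  have hB : ‖K * ((u * E') * mixProd G p q (3 * n / 4) k j)‖ ≤
      (1 + 16 * Real.exp 4) * (2 * (32 * Real.exp 22000 * 2)) * Z := by
    calc _ ≤ (1 + 16 * Real.exp 4) * (2 / √(n * q) *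
          (32 * Real.exp 22000 * (1 + √(1 / ((n : ℝ) * q ^ 3))))) := by
          refine (norm_mul_le _ _).trans ?_
          gcongr
          refine (norm_mul_le _ _).trans ?_
          gcongr
      _ = (1 + 16 * Real.exp 4) * (2 * (32 * Real.exp 22000)) *
          (1 / √(n * q) * (1 + √(1 / ((n : ℝ) * q ^ 3)))) := by ring
      _ ≤ (1 + 16 * Real.exp 4) * (2 * (32 * Real.exp 22000)) * (2 * Z) := by gcongr
      _ = _ := by ring
  refine (norm_add_le _ _).trans ((add_le_add hA hB).trans ?_)
  have hfin : errConst / (q ^ (7 / 2 : ℝ) * √n) = errConst * Z := by rw [hZ]; ring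
  have hce := errConst_pos
  rw [hfin]
  calc _ = 3.5 / 3 + 1 / 3 * (errConst * Z) := by unfold errConst; ring
    _ ≤ 3.5 / 3 * (1 + errConst * Z) := by
        have : 0 ≤ errConst * Z := by positivity
        norm_num
        linarith

end Expansion

/-! ### Telescoping and the leading constant -/

section Main

variable {𝔸 : Type*} [NormedCommRing 𝔸] [NormedAlgebra ℝ 𝔸] [NormOneClass 𝔸] [CompleteSpace 𝔸]
  {Λ : Type*} [AddCommGroup Λ]

/-- The estimate for symmetric mixtures of shifts in a Banach algebra. -/
theorem norm_pow_sub_exp_pow_le {S : Λ → 𝔸} (hSadd : ∀ x y, S (x + y) = S x * S y)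
    (hS0 : S 0 = 1) (hSn : ∀ x, ‖S x‖ ≤ 1) (htor : ∀ x : Λ, x ≠ 0 → x ≠ -x) {f : Λ → ℝ}
    (hf : ∀ x, 0 ≤ f x) (hf1 : HasSum f 1) (hsymm : ∀ x, f (-x) = f x) (hf0 : 0 < f 0)
    (hf0' : f 0 < 1) {T : 𝔸} (hT : HasSum (fun x => f x • S x) T) {n : ℕ} (hn : 1 ≤ n) :
    1 / 2 * ‖T ^ n - NormedSpace.exp (T - 1 - (1 / 2 : ℝ) • (T - 1) ^ 2) ^ n‖ ≤
      50.2 * (∑' x : {x : Λ // x ≠ 0}, min 1 (n * f 0 / 6 * Real.exp 1 * f x)) ^ 3 /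
        (f 0 ^ (7 / 2 : ℝ) * (n : ℝ) ^ 2) * (1 + errConst / (f 0 ^ (7 / 2 : ℝ) * √n)) := by
  classical
  set q := f 0 with hq
  set p := 1 - q with hp
  have hp0 : 0 < p := by linarith
  have hn0 : (0 : ℝ) < n := by exact_mod_cast hn
  set δ := ∑' x : {x : Λ // x ≠ 0}, min 1 (n * q / 6 * Real.exp 1 * f x) with hδ
  have hδ0 : 0 ≤ δ := tsum_nonneg fun x => le_min zero_le_one
    (mul_nonneg (by positivity) (hf _))
  -- G is the mixture conditioned on a nonzero shift, so T = q + pG. Deleting the mass at 0 leaves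
  -- nonnegative weights of total p.
  set G : 𝔸 := p⁻¹ • (T - q • 1) with hGdef
  have hG : ‖G‖ ≤ 1 := by
    have h1 : HasSum (fun y => f y - (if y = 0 then q else 0)) (1 - q) :=
      hf1.sub (hasSum_ite_eq 0 q)
    have h2 : HasSum (fun y => (f y - (if y = 0 then q else 0)) • S y) (T - q • 1) := by
      rw [← hS0]
      refine (hT.sub (hasSum_ite_eq 0 (q • S 0))).congr_fun fun y => ?_
      by_cases h3 : y = 0
      · subst h3
        rw [if_pos rfl, if_pos rfl, sub_smul]
      · rw [if_neg h3, if_neg h3, sub_zero, sub_zero]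
    have hn := norm_le_of_hasSum_smul hSn (fun y => ?_) h1 h2
    · rw [hGdef, norm_smul, Real.norm_of_nonneg (by positivity), inv_mul_le_one₀ hp0]
      exact hn
    · by_cases h3 : y = 0
      · subst h3
        rw [if_pos rfl, hq, sub_self]
      · rw [if_neg h3, sub_zero]
        exact hf y
  have hu : T - 1 = p • (G - 1) := by
    rw [hGdef, smul_sub, smul_smul, mul_inv_cancel₀ hp0.ne', one_smul, hp]
    module
  have ht := norm_generator_mul_exp_le hSadd hS0 hSn htor hf hf1 hsymm hT
    (s := n * q / 6) (by positivity)
  set u := T - 1 with hudef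
  have hT1 : T = 1 + u := by rw [hudef]; ring
  rw [hT1, ← geom_sum₂_mul, Finset.sum_mul]
  set t := 2 / (Real.exp 1 * (n * q / 6)) * δ with htdef
  have hterm : ∀ i ∈ Finset.range n, ‖(1 + u) ^ i *
      NormedSpace.exp (u - (1 / 2 : ℝ) • u ^ 2) ^ (n - 1 - i) *
      (1 + u - NormedSpace.exp (u - (1 / 2 : ℝ) • u ^ 2))‖ ≤
      t ^ 3 * (3.5 / 3 * (1 + errConst / (q ^ (7 / 2 : ℝ) * √n))) := by
    intro i hi
    have := Finset.mem_range.1 hi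
    exact norm_telescope_term_le hG hp0 hf0 (by rw [hp]; ring) (by omega) hu ht
  have hsum := (norm_sum_le _ _).trans (Finset.sum_le_sum hterm)
  rw [Finset.sum_const, Finset.card_range, nsmul_eq_mul] at hsum
  set W := 1 + errConst / (q ^ (7 / 2 : ℝ) * √n) with hW
  have hW0 : 0 ≤ W := by have := errConst_pos; positivity
  -- The precision is what the constant requires: 50.2 · 20.08 just exceeds 1008.
  have he3 : 20.08 ≤ Real.exp 1 ^ 3 := by
    have := Real.exp_one_gt_d9
    calc (20.08 : ℝ) ≤ 2.718 ^ 3 - 0.01 + 0.011 := by norm_num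
      _ ≤ 2.7182818283 ^ 3 := by norm_num
      _ ≤ _ := by gcongr
  have hq1 : q ^ (7 / 2 : ℝ) ≤ q ^ 3 := by
    rw [← Real.rpow_natCast q 3]
    exact Real.rpow_le_rpow_of_exponent_ge hf0 hf0'.le (by norm_num)
  calc _ ≤ 1 / 2 * (n * (t ^ 3 * (3.5 / 3 * W))) := by gcongr
    -- 1008 = (1/2) · 12³ · 3.5/3, where 12 comes from the smoothing bound 2/(e · nq/6). The next
    -- line weakens q³ to q^(7/2).
    _ = 1008 / Real.exp 1 ^ 3 * (δ ^ 3 / (q ^ 3 * (n : ℝ) ^ 2) * W) := by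
        rw [htdef]
        field_simp
        ring
    _ ≤ 50.2 * (δ ^ 3 / (q ^ (7 / 2 : ℝ) * (n : ℝ) ^ 2) * W) := by
        gcongr
        rw [div_le_iff₀ (by positivity)]
        norm_num at he3 ⊢
        linarith
    _ = _ := by ring

end Main

/-! ### The convolution Banach algebra of discrete measures -/

section L1

variable {E : Type*}

/-- The sum of the absolute values of the coefficients. -/
noncomputable def coeffNorm (a : AddMonoidAlgebra ℝ E) : ℝ := a.coeff.sum fun _ r => |r|

theorem coeffNorm_single (x : E) (r : ℝ) : coeffNorm (AddMonoidAlgebra.single x r) = |r| := by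
  simp [coeffNorm]

theorem coeffNorm_eq_sum {a : AddMonoidAlgebra ℝ E} {s : Finset E} (h : a.coeff.support ⊆ s) :
    coeffNorm a = ∑ x ∈ s, |a.coeff x| :=
  Finsupp.sum_of_support_subset _ h _ fun _ _ => abs_zero

variable [AddCommGroup E]

theorem coeffNorm_add_le (a b : AddMonoidAlgebra ℝ E) :
    coeffNorm (a + b) ≤ coeffNorm a + coeffNorm b := by
  classical
  rw [coeffNorm_eq_sum (s := a.coeff.support ∪ b.coeff.support)
      (by rw [AddMonoidAlgebra.coeff_add]; exact Finsupp.support_add),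
    coeffNorm_eq_sum (s := a.coeff.support ∪ b.coeff.support) Finset.subset_union_left,
    coeffNorm_eq_sum (s := a.coeff.support ∪ b.coeff.support) Finset.subset_union_right,
    ← Finset.sum_add_distrib]
  refine Finset.sum_le_sum fun x _ => ?_
  rw [AddMonoidAlgebra.coeff_add, Finsupp.add_apply]
  exact abs_add_le _ _

theorem coeffNorm_zero : coeffNorm (0 : AddMonoidAlgebra ℝ E) = 0 := by simp [coeffNorm]

theorem coeffNorm_smul (c : ℝ) (a : AddMonoidAlgebra ℝ E) :
    coeffNorm (c • a) = |c| * coeffNorm a := by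
  rw [coeffNorm_eq_sum (s := a.coeff.support)
    (by rw [AddMonoidAlgebra.coeff_smul]; exact Finsupp.support_smul),
    coeffNorm_eq_sum (s := a.coeff.support) subset_rfl, Finset.mul_sum]
  refine Finset.sum_congr rfl fun x _ => ?_
  rw [AddMonoidAlgebra.coeff_smul, Finsupp.smul_apply, smul_eq_mul, abs_mul]

theorem coeffNorm_neg (a : AddMonoidAlgebra ℝ E) : coeffNorm (-a) = coeffNorm a := by
  rw [← neg_one_smul ℝ a, coeffNorm_smul, abs_neg, abs_one, one_mul]

theorem coeffNorm_sum_le {ι : Type*} (s : Finset ι) (f : ι → AddMonoidAlgebra ℝ E) :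
    coeffNorm (∑ i ∈ s, f i) ≤ ∑ i ∈ s, coeffNorm (f i) :=
  Finset.le_sum_of_subadditive _ coeffNorm_zero.le coeffNorm_add_le _ _

theorem coeffNorm_mul_le (a b : AddMonoidAlgebra ℝ E) :
    coeffNorm (a * b) ≤ coeffNorm a * coeffNorm b := by
  rw [AddMonoidAlgebra.mul_def]
  unfold Finsupp.sum
  refine (coeffNorm_sum_le _ _).trans ?_
  rw [coeffNorm, Finsupp.sum, Finset.sum_mul]
  refine Finset.sum_le_sum fun x _ => (coeffNorm_sum_le _ _).trans ?_
  rw [coeffNorm, Finsupp.sum, Finset.mul_sum]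
  refine Finset.sum_le_sum fun y _ => ?_
  rw [coeffNorm_single, abs_mul]

/-- A seminorm is enough, since the completion taken below is separated. -/
noncomputable instance : SeminormedCommRing (AddMonoidAlgebra ℝ E) where
  __ := AddGroupSeminorm.toSeminormedAddCommGroup
    (⟨coeffNorm, coeffNorm_zero, coeffNorm_add_le, coeffNorm_neg⟩ :
      AddGroupSeminorm (AddMonoidAlgebra ℝ E))
  __ := (inferInstance : CommRing (AddMonoidAlgebra ℝ E))
  norm_mul_le := coeffNorm_mul_le

noncomputable instance : NormedAlgebra ℝ (AddMonoidAlgebra ℝ E) where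
  norm_smul_le c a := (coeffNorm_smul c a).le

/-- The commutative Banach algebra of discrete finite signed measures under convolution. -/
abbrev L1Algebra (E : Type*) [AddCommGroup E] : Type _ := UniformSpace.Completion (AddMonoidAlgebra ℝ E)

/-- The unit mass at a point. -/
noncomputable def shift (x : E) : L1Algebra E :=
  ((AddMonoidAlgebra.single x (1 : ℝ) : AddMonoidAlgebra ℝ E) : L1Algebra E)

theorem norm_shift (x : E) : ‖shift x‖ = 1 := by
  rw [shift, UniformSpace.Completion.norm_coe]
  exact (coeffNorm_single x 1).trans abs_one

theorem shift_zero : shift (0 : E) = 1 := rfl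

theorem shift_add (x y : E) : shift (x + y) = shift x * shift y := by
  rw [shift, shift, shift, ← UniformSpace.Completion.coe_mul, AddMonoidAlgebra.single_mul_single,
    one_mul]

instance : NormOneClass (L1Algebra E) := ⟨by rw [← shift_zero]; exact norm_shift 0⟩

/-- Finite combinations of point masses are dense, so identities between integration functionals
need only be checked at points. -/
theorem clm_ext_shift {L L' : L1Algebra E →L[ℝ] ℝ} (h : ∀ x, L (shift x) = L' (shift x)) :
    L = L' := by
  ext a
  induction a using UniformSpace.Completion.induction_on with
  | hp => exact isClosed_eq L.continuous L'.continuous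
  | ih a =>
    have key : (L.toLinearMap ∘ₗ (UniformSpace.Completion.toComplL (𝕜 := ℝ)
        (E := AddMonoidAlgebra ℝ E)).toLinearMap).toAddMonoidHom =
        (L'.toLinearMap ∘ₗ (UniformSpace.Completion.toComplL (𝕜 := ℝ)
        (E := AddMonoidAlgebra ℝ E)).toLinearMap).toAddMonoidHom := by
      refine AddMonoidAlgebra.addMonoidHom_ext fun x r => ?_
      have e : AddMonoidAlgebra.single x r = r • AddMonoidAlgebra.single x (1 : ℝ) := by
        rw [AddMonoidAlgebra.smul_single, smul_eq_mul, mul_one]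
      have h' := h x
      rw [shift] at h'
      simp only [LinearMap.toAddMonoidHom_coe, LinearMap.comp_apply, e, map_smul]
      exact congrArg (r • ·) h'
    exact DFunLike.congr_fun key a

/-- Integration of the bounded function `g`, before completion. -/
noncomputable def preIntegral (g : E → ℝ) (hg : ∀ x, |g x| ≤ 1) : AddMonoidAlgebra ℝ E →L[ℝ] ℝ :=
  LinearMap.mkContinuous
    { toFun := fun a => a.coeff.sum fun x r => r * g x
      map_add' := fun a b => by
        rw [AddMonoidAlgebra.coeff_add]
        exact Finsupp.sum_add_index' (fun _ => zero_mul _) fun _ _ _ => add_mul _ _ _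
      map_smul' := fun c a => by
        rw [AddMonoidAlgebra.coeff_smul, Finsupp.sum_smul_index' fun _ => zero_mul _]
        simp only [smul_eq_mul, RingHom.id_apply, Finsupp.mul_sum, mul_assoc] }
    1 fun a => by
      rw [one_mul]
      refine (norm_sum_le _ _).trans (Finset.sum_le_sum fun x _ => ?_)
      rw [norm_mul, Real.norm_eq_abs, Real.norm_eq_abs]
      exact mul_le_of_le_one_right (abs_nonneg _) (hg x)

/-- Integration of the bounded function `g`. -/
noncomputable def integralCLM (g : E → ℝ) (hg : ∀ x, |g x| ≤ 1) : L1Algebra E →L[ℝ] ℝ :=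
  (preIntegral g hg).extend UniformSpace.Completion.toComplL

theorem integralCLM_coe (g : E → ℝ) (hg : ∀ x, |g x| ≤ 1) (a : AddMonoidAlgebra ℝ E) :
    integralCLM g hg (a : L1Algebra E) = preIntegral g hg a :=
  ContinuousLinearMap.extend_eq _ UniformSpace.Completion.denseRange_coe
    (UniformSpace.Completion.isUniformInducing_coe _) a

theorem integralCLM_shift (g : E → ℝ) (hg : ∀ x, |g x| ≤ 1) (x : E) :
    integralCLM g hg (shift x) = g x := by
  rw [shift, integralCLM_coe]
  simp [preIntegral]

theorem abs_integralCLM_le (g : E → ℝ) (hg : ∀ x, |g x| ≤ 1) (a : L1Algebra E) :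
    |integralCLM g hg a| ≤ ‖a‖ := by
  induction a using UniformSpace.Completion.induction_on with
  | hp => exact isClosed_le (by fun_prop) (by fun_prop)
  | ih a =>
    rw [integralCLM_coe, UniformSpace.Completion.norm_coe]
    refine ((preIntegral g hg).le_opNorm a).trans ?_
    exact mul_le_of_le_one_left (norm_nonneg _) (LinearMap.mkContinuous_norm_le _ zero_le_one _)

theorem integralCLM_one_shift_mul (x : E) (a : L1Algebra E) :
    integralCLM (fun _ => 1) (fun _ => abs_one.le) (shift x * a) =
      integralCLM (fun _ => 1) (fun _ => abs_one.le) a := by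
  have : (integralCLM (fun _ : E => (1 : ℝ)) (fun _ => abs_one.le)).comp
      (ContinuousLinearMap.mul ℝ (L1Algebra E) (shift x)) =
      integralCLM (fun _ => 1) (fun _ => abs_one.le) := by
    refine clm_ext_shift fun y => ?_
    simp only [ContinuousLinearMap.comp_apply, ContinuousLinearMap.mul_apply', ← shift_add,
      integralCLM_shift]
  exact DFunLike.congr_fun this a

/-- An element of vanishing total mass gives each set at most half of its norm. -/
theorem abs_integralCLM_indicator_le {A : Set E} (hA : ∀ x, |A.indicator (fun _ => (1 : ℝ)) x| ≤ 1)
    {a : L1Algebra E} (ha : integralCLM (fun _ => 1) (fun _ => abs_one.le) a = 0) :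
    |integralCLM (A.indicator fun _ => 1) hA a| ≤ 1 / 2 * ‖a‖ := by
  classical
  have hg : ∀ x, |(fun x => if x ∈ A then (1 : ℝ) else -1) x| ≤ 1 := fun x => by
    by_cases h : x ∈ A <;> simp [h]
  -- The indicator is half of the ±1 valued function plus half of the constant 1, and the constant
  -- integrates to zero. This is the source of the factor 1/2.
  have : integralCLM (A.indicator fun _ => 1) hA = (1 / 2 : ℝ) • integralCLM _ hg +
      (1 / 2 : ℝ) • integralCLM (fun _ => 1) (fun _ => abs_one.le) := by
    refine clm_ext_shift fun x => ?_
    simp only [add_apply, smul_apply, integralCLM_shift,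
      smul_eq_mul]
    by_cases h : x ∈ A <;> norm_num [h]
  rw [this, add_apply, smul_apply,
    smul_apply, ha, smul_zero, add_zero, smul_eq_mul, abs_mul,
    abs_of_nonneg (by norm_num : (0 : ℝ) ≤ 1 / 2)]
  gcongr
  exact abs_integralCLM_le _ hg a

end L1

/-! ### Discrete signed measures -/

section Atomic

/-- The discrete signed measure with masses `w`. -/
noncomputable def atomic {X : Type*} [MeasurableSpace X] (w : X → ℝ) (hw : Summable w) :
    SignedMeasure X where
  measureOf' A := by
    classical
    exact if MeasurableSet A then ∑' x, A.indicator w x else 0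
  empty' := by simp
  not_measurable' A hA := by simp [hA]
  m_iUnion' f hf hd := by
    simp only [hf, MeasurableSet.iUnion hf, if_true]
    have hx : ∀ x, HasSum (fun i => (f i).indicator (fun x => |w x|) x)
        ((⋃ i, f i).indicator (fun x => |w x|) x) := by
      intro x
      by_cases h : x ∈ ⋃ i, f i
      · obtain ⟨i, hi⟩ := Set.mem_iUnion.1 h
        rw [Set.indicator_of_mem h, ← Set.indicator_of_mem hi (fun x => |w x|)]
        refine hasSum_single i fun j hj => Set.indicator_of_notMem (fun hxj => ?_) _
        exact (Set.disjoint_left.1 (hd hj) hxj hi)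
      · rw [Set.indicator_of_notMem h]
        have h0 : ∀ i, (f i).indicator (fun x => |w x|) x = 0 := fun i =>
          Set.indicator_of_notMem (fun hi => h (Set.mem_iUnion.2 ⟨i, hi⟩)) _
        simp only [h0]
        exact hasSum_zero
    have hx' : ∀ x, HasSum (fun i => (f i).indicator w x) ((⋃ i, f i).indicator w x) := by
      intro x
      -- Factoring out the sign of w x reduces the signed statement to the one for |w x|.
      have h1 : ∀ B : Set X, B.indicator w x = SignType.sign (w x) * B.indicator (fun x => |w x|) x := by
        intro B
        by_cases h : x ∈ B <;> simp [h]
      simp only [h1]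
      exact (hx x).mul_left _
    have hs : Summable fun p : X × ℕ => (f p.2).indicator (fun x => |w x|) p.1 := by
      rw [summable_prod_of_nonneg fun p => Set.indicator_nonneg (fun _ _ => abs_nonneg _) _]
      refine ⟨fun x => (hx x).summable, ?_⟩
      simp only [fun x => (hx x).tsum_eq]
      exact hw.abs.indicator _
    have hs' : Summable fun p : X × ℕ => (f p.2).indicator w p.1 := by
      refine Summable.of_norm_bounded hs fun p => ?_
      by_cases h : p.1 ∈ f p.2 <;> simp [h]
    have h1 := hs'.hasSum.prod_fiberwise hx'
    have h2 := ((Equiv.prodComm ℕ X).hasSum_iff.mpr hs'.hasSum).prod_fiberwise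
      fun i => (hw.indicator (f i)).hasSum
    rw [h1.tsum_eq]
    exact h2

theorem hasSum_atomic {X : Type*} [MeasurableSpace X] {w : X → ℝ} (hw : Summable w) {A : Set X}
    (hA : MeasurableSet A) : HasSum (A.indicator w) (atomic w hw A) := by
  have : atomic w hw A = ∑' x, A.indicator w x := if_pos hA
  rw [this]
  exact (hw.indicator A).hasSum

theorem abs_indicator_one_le {E : Type*} (A : Set E) (x : E) : |A.indicator (fun _ => (1 : ℝ)) x| ≤ 1 := by
  by_cases h : x ∈ A <;> simp [h]

/-- Regrouping a double sum over pairs according to the sum of the pair. -/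
theorem hasSum_regroup {E V : Type*} [AddCommGroup E] [NormedAddCommGroup V] [NormedSpace ℝ V] {w w' : E → ℝ}
    (hw : Summable w) (hw' : Summable w') (h : E → V) {T : V}
    (hT : HasSum (fun p : E × E => (w p.1 * w' p.2) • h (p.1 + p.2)) T) :
    HasSum (fun z => (∑' x, w x * w' (z - x)) • h z) T := by
  let e : E × E ≃ E × E :=
    { toFun := fun p => (p.2, p.1 - p.2)
      invFun := fun p => (p.1 + p.2, p.1)
      left_inv := fun p => by simp
      right_inv := fun p => by simp }
  have hs : Summable fun p : E × E => w p.1 * w' p.2 :=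
    summable_mul_of_summable_norm hw.norm hw'.norm
  have h1 := e.summable_iff.2 hs
  have h2 := e.hasSum_iff.2 hT
  refine h2.prod_fiberwise fun z => ?_
  have h3 : Summable fun x => w x * w' (z - x) := h1.prod_factor z
  refine (h3.hasSum.smul_const (h z)).congr_fun fun x => ?_
  simp [e]

theorem hasSum_smul_mul_smul {ι R : Type*} [NormedRing R] [NormedAlgebra ℝ R] [CompleteSpace R]
    {S : ι → R} (hS : ∀ x, ‖S x‖ ≤ 1) {w w' : ι → ℝ} (hw : Summable w) (hw' : Summable w')
    {a b : R} (ha : HasSum (fun x => w x • S x) a) (hb : HasSum (fun x => w' x • S x) b) :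
    HasSum (fun p : ι × ι => (w p.1 * w' p.2) • (S p.1 * S p.2)) (a * b) := by
  have hn : ∀ v : ι → ℝ, Summable v → Summable fun x => ‖v x • S x‖ := fun v hv =>
    Summable.of_nonneg_of_le (fun _ => norm_nonneg _) (fun x => by
      rw [norm_smul]
      exact mul_le_of_le_one_right (norm_nonneg _) (hS x)) hv.norm
  have hs : Summable fun p : ι × ι => (w p.1 • S p.1) * (w' p.2 • S p.2) :=
    summable_mul_of_summable_norm (f := fun x => w x • S x) (g := fun x => w' x • S x)
      (hn w hw) (hn w' hw')
  have h := HasSum.mul (f := fun x => w x • S x) (g := fun x => w' x • S x) ha hb hs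
  simpa only [smul_mul_smul_comm] using h

variable {E : Type*} [AddCommGroup E] [MeasurableSpace E]

/-- The signed measure `M` is discrete and corresponds to `a` in the convolution algebra. -/
def Represents (M : SignedMeasure E) (a : L1Algebra E) : Prop :=
  ∃ w : E → ℝ, Summable w ∧ (∀ A, MeasurableSet A → HasSum (A.indicator w) (M A)) ∧
    HasSum (fun x => w x • shift x) a

theorem Represents.apply_eq {M : SignedMeasure E} {a : L1Algebra E} (h : Represents M a) {A : Set E}
    (hA : MeasurableSet A) :
    M A = integralCLM (A.indicator fun _ => 1) (abs_indicator_one_le A) a := by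
  obtain ⟨w, -, h1, h2⟩ := h
  refine (h1 A hA).unique ?_
  refine ((integralCLM _ (abs_indicator_one_le A)).hasSum h2).congr_fun fun x => ?_
  rw [map_smul, integralCLM_shift]
  by_cases h : x ∈ A <;> simp [h]

theorem Represents.sub {M V : SignedMeasure E} {a b : L1Algebra E} (h : Represents M a)
    (h' : Represents V b) : Represents (M - V) (a - b) := by
  obtain ⟨w, hw, h1, h2⟩ := h
  obtain ⟨w', hw', h1', h2'⟩ := h'
  refine ⟨fun x => w x - w' x, hw.sub hw', fun A hA => ?_, ?_⟩
  · rw [sub_apply]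
    exact ((h1 A hA).sub (h1' A hA)).congr_fun fun x => by
      by_cases h : x ∈ A <;> simp [h]
  · exact (h2.sub h2').congr_fun fun x => sub_smul _ _ _

theorem Represents.smul {M : SignedMeasure E} {a : L1Algebra E} (h : Represents M a) (c : ℝ) :
    Represents (c • M) (c • a) := by
  obtain ⟨w, hw, h1, h2⟩ := h
  refine ⟨fun x => c * w x, hw.mul_left c, fun A hA => ?_, ?_⟩
  · rw [smul_apply]
    exact ((h1 A hA).mul_left c).congr_fun fun x => by
      by_cases h : x ∈ A <;> simp [h]
  · exact (h2.const_smul c).congr_fun fun x => mul_smul _ _ _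

theorem represents_unitMass [MeasurableSingletonClass E] :
    Represents (unitMass E) (1 : L1Algebra E) := by
  classical
  have h1 : ∀ x : E, x ≠ 0 → (if x = 0 then (1 : ℝ) else 0) = 0 := fun x hx => if_neg hx
  refine ⟨fun x => if x = 0 then 1 else 0, (hasSum_ite_eq 0 1).summable, fun A hA => ?_, ?_⟩
  · rw [unitMass, Measure.toSignedMeasure_apply_measurable hA]
    have := hasSum_single (f := A.indicator fun x : E => if x = 0 then (1 : ℝ) else 0) 0
      fun x hx => by by_cases h : x ∈ A <;> simp [h, h1 x hx]
    convert this using 1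
    by_cases h : (0 : E) ∈ A <;> simp [h, measureReal_def, Measure.dirac_apply' _ hA]
  · have := hasSum_single (f := fun x : E => (if x = 0 then (1 : ℝ) else 0) • shift x) 0
      fun x hx => by rw [h1 x hx, zero_smul]
    rwa [if_pos rfl, one_smul, shift_zero] at this

/-- Product vector measures are determined on rectangles, so the product of two discrete measures is
the discrete one with masses w x · w' y. Its image under addition is obtained by regrouping
absolutely convergent sums. -/
theorem Represents.conv [MeasurableAdd₂ E] {M V : SignedMeasure E} {a b : L1Algebra E}
    (h : Represents M a) (h' : Represents V b) : Represents (conv M V) (a * b) := by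
  obtain ⟨w, hw, h1, h2⟩ := h
  obtain ⟨w', hw', h1', h2'⟩ := h'
  have hs : Summable fun p : E × E => w p.1 * w' p.2 :=
    summable_mul_of_summable_norm hw.norm hw'.norm
  have hprod : VectorMeasure.prod M V (ContinuousLinearMap.mul ℝ ℝ) =
      atomic (fun p : E × E => w p.1 * w' p.2) hs := by
    refine VectorMeasure.prod_eq_of_forall_apply_prod fun s t hms hmt => ?_
    rw [ContinuousLinearMap.mul_apply']
    refine (hasSum_atomic hs (hms.prod hmt)).unique ?_
    have h3 := (h1 s hms).mul (h1' t hmt)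
      (summable_mul_of_summable_norm (hw.indicator s).norm (hw'.indicator t).norm)
    refine h3.congr_fun fun p => ?_
    by_cases hp1 : p.1 ∈ s <;> by_cases hp2 : p.2 ∈ t <;> simp [hp1, hp2]
  have hconv : Summable fun z => ∑' x, w x * w' (z - x) := by
    have := hasSum_regroup hw hw' (fun _ => (1 : ℝ)) (T := ∑' p : E × E, w p.1 * w' p.2) (by
      simpa using hs.hasSum)
    simpa using this.summable
  refine ⟨_, hconv, fun A hA => ?_, ?_⟩
  · have h3 := hasSum_regroup hw hw' (A.indicator fun _ => (1 : ℝ)) (T := SignedCP.conv M V A) (by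
      rw [conv_apply _ _ hA, hprod]
      refine (hasSum_atomic hs (measurable_add hA)).congr_fun fun p => ?_
      by_cases hp : p.1 + p.2 ∈ A <;> simp [hp])
    refine h3.congr_fun fun z => ?_
    by_cases hz : z ∈ A <;> simp [hz]
  · refine hasSum_regroup hw hw' shift ?_
    refine (hasSum_smul_mul_smul (fun x => (norm_shift x).le) hw hw' h2 h2').congr_fun fun p => ?_
    rw [shift_add]

theorem Represents.convPow [MeasurableAdd₂ E] [MeasurableSingletonClass E] {M : SignedMeasure E}
    {a : L1Algebra E} (h : Represents M a) (n : ℕ) : Represents (convPow M n) (a ^ n) := by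
  induction n with
  | zero => rw [pow_zero]; exact represents_unitMass
  | succ n ih => rw [pow_succ]; exact ih.conv h

/-- The exponential series converges in norm, and evaluation at A is a continuous functional, so it
agrees with the setwise series. -/
theorem Represents.expMeasure_apply [MeasurableAdd₂ E] [MeasurableSingletonClass E]
    {M : SignedMeasure E} {a : L1Algebra E} (h : Represents M a) {A : Set E}
    (hA : MeasurableSet A) : expMeasure M A =
      integralCLM (A.indicator fun _ => 1) (abs_indicator_one_le A) (NormedSpace.exp a) := by
  refine (hasSum_expMeasure M hA).unique ?_
  refine ((integralCLM _ (abs_indicator_one_le A)).hasSum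
    (NormedSpace.exp_series_hasSum_exp' (𝕂 := ℝ) a)).congr_fun fun j => ?_
  rw [map_smul, (h.convPow j).apply_eq hA, smul_eq_mul, div_eq_inv_mul]

end Atomic

/-! ### Lattice distributions -/

section Lattice

variable {d : ℕ}

theorem latticePoint_injective : Function.Injective (latticePoint (d := d)) := fun x y h => by
  funext i
  have h' : (x i : ℝ) = (y i : ℝ) := congrFun h i
  exact_mod_cast h'

theorem latticePoint_add (x y : Fin d → ℤ) :
    latticePoint (x + y) = latticePoint x + latticePoint y := by
  funext i
  simp [latticePoint]

theorem latticePoint_neg (x : Fin d → ℤ) : latticePoint (-x) = -latticePoint x := by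
  funext i
  simp [latticePoint]

theorem latticePoint_zero : latticePoint (0 : Fin d → ℤ) = 0 := by
  funext i
  simp [latticePoint]

theorem hasSum_lattice_masses {F : Measure (Fin d → ℝ)} [IsProbabilityMeasure F]
    (hF : F (Set.range (latticePoint (d := d)))ᶜ = 0) {A : Set (Fin d → ℝ)}
    (hA : MeasurableSet A) :
    HasSum (fun x : Fin d → ℤ => A.indicator (fun y => F.real {y}) (latticePoint x))
      (F.toSignedMeasure A) := by
  have h := VectorMeasure.hasSum_of_disjoint_iUnion (v := F.toSignedMeasure)
    (f := fun x : Fin d → ℤ => A ∩ {latticePoint x})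
    (fun x => hA.inter (measurableSet_singleton _)) (fun x y hxy => by
      refine Set.disjoint_left.2 fun z hz hz' => hxy (latticePoint_injective ?_)
      exact hz.2.symm.trans hz'.2)
  have e : F.toSignedMeasure (⋃ x : Fin d → ℤ, A ∩ {latticePoint x}) = F.toSignedMeasure A := by
    have hset : (⋃ x : Fin d → ℤ, A ∩ {latticePoint x}) = A ∩ Set.range latticePoint := by
      rw [← Set.inter_iUnion, Set.iUnion_singleton_eq_range]
    rw [hset]
    have hm : MeasurableSet (Set.range (latticePoint (d := d))) :=
      (Set.countable_range _).measurableSet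
    rw [Measure.toSignedMeasure_apply_measurable hA,
      Measure.toSignedMeasure_apply_measurable (hA.inter hm), measureReal_def, measureReal_def,
      measure_inter_conull hF]
  rw [e] at h
  refine h.congr_fun fun x => ?_
  by_cases hx : latticePoint x ∈ A
  · rw [Set.indicator_of_mem hx, Set.inter_eq_right.2 (Set.singleton_subset_iff.2 hx),
      Measure.toSignedMeasure_apply_measurable (measurableSet_singleton _)]
  · rw [Set.indicator_of_notMem hx, Set.inter_singleton_eq_empty.2 hx, VectorMeasure.empty]

theorem measureReal_singleton_eq_zero {F : Measure (Fin d → ℝ)}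
    (hF : F (Set.range (latticePoint (d := d)))ᶜ = 0) {x : Fin d → ℝ}
    (hx : x ∉ Set.range (latticePoint (d := d))) : F.real {x} = 0 := by
  rw [measureReal_def, measure_mono_null (Set.singleton_subset_iff.2 hx) hF, ENNReal.toReal_zero]

/-- The element of the convolution algebra that corresponds to a lattice distribution. -/
theorem exists_represents_lattice {F : Measure (Fin d → ℝ)} [IsProbabilityMeasure F]
    (hF : F (Set.range (latticePoint (d := d)))ᶜ = 0) :
    ∃ T : L1Algebra (Fin d → ℝ), Represents F.toSignedMeasure T ∧
      HasSum (fun x : Fin d → ℤ => F.real {latticePoint x} • shift (latticePoint x)) T := by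
  have hsum := hasSum_lattice_masses hF MeasurableSet.univ
  simp only [Set.indicator_univ] at hsum
  have hT : Summable fun x : Fin d → ℤ => F.real {latticePoint x} • shift (latticePoint x) := by
    refine Summable.of_norm_bounded hsum.summable fun x => ?_
    rw [norm_smul, norm_shift, mul_one, Real.norm_of_nonneg measureReal_nonneg]
  refine ⟨_, ⟨fun y => F.real {y}, ?_, fun A hA => ?_, ?_⟩, hT.hasSum⟩
  · rw [← latticePoint_injective.summable_iff fun x hx => measureReal_singleton_eq_zero hF hx]
    exact hsum.summable
  · rw [← latticePoint_injective.hasSum_iff (f := A.indicator fun y => F.real {y}) fun x hx =>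
      Set.indicator_apply_eq_zero.2 fun _ => measureReal_singleton_eq_zero hF hx]
    exact hasSum_lattice_masses hF hA
  · rw [← latticePoint_injective.hasSum_iff fun x hx => by
      simp only [measureReal_singleton_eq_zero hF hx, zero_smul]]
    exact hT.hasSum

theorem tvDist_convPow_hippPow_le {F : Measure (Fin d → ℝ)} [IsProbabilityMeasure F]
    (hF : IsSymmetricLattice F) {n : ℕ} (hn : 1 ≤ n) :
    tvDist (convPow F.toSignedMeasure n) (hippPow F n) ≤
      50.2 * delta F (n * F.real {0} / 6) ^ 3 / (F.real {0} ^ (7 / 2 : ℝ) * (n : ℝ) ^ 2) *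
        (1 + errConst / (F.real {0} ^ (7 / 2 : ℝ) * √(n : ℝ))) := by
  obtain ⟨T, hT, hTsum⟩ := exists_represents_lattice hF.lattice
  have hf1 : HasSum (fun x : Fin d → ℤ => F.real {latticePoint x}) 1 := by
    have h := hasSum_lattice_masses hF.lattice MeasurableSet.univ
    simp only [Set.indicator_univ] at h
    rwa [Measure.toSignedMeasure_apply_measurable MeasurableSet.univ, probReal_univ] at h
  have hsymm : ∀ x : Fin d → ℤ, F.real {latticePoint (-x)} = F.real {latticePoint x} := by
    intro x
    rw [latticePoint_neg]
    conv_lhs => rw [← hF.symm]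
    rw [measureReal_def, Measure.map_apply measurable_neg (measurableSet_singleton _),
      measureReal_def]
    congr 2
    ext y
    simp
  have hmain := norm_pow_sub_exp_pow_le (S := fun x : Fin d → ℤ => shift (latticePoint x))
    (fun x y => by rw [latticePoint_add, shift_add]) (by rw [latticePoint_zero, shift_zero])
    (fun x => (norm_shift _).le) (fun x hx h => hx (self_eq_neg.1 h)) (fun x => measureReal_nonneg) hf1 hsymm
    (by rw [latticePoint_zero]; exact hF.zero_pos) (by rw [latticePoint_zero]; exact hF.zero_lt_one)
    hTsum hn
  rw [latticePoint_zero] at hmain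
  set X : L1Algebra (Fin d → ℝ) :=
    T ^ n - NormedSpace.exp (T - 1 - (1 / 2 : ℝ) • (T - 1) ^ 2) ^ n with hX
  -- X has the form (T - 1)y, and multiplication by the probability T preserves total mass because
  -- each shift does. Hence the total mass of X is zero.
  have hX0 : integralCLM (fun _ => 1) (fun _ => abs_one.le) X = 0 := by
    have hTn : ‖T‖ ≤ 1 := norm_le_of_hasSum_smul (fun x => (norm_shift _).le)
      (fun x => measureReal_nonneg) hf1 hTsum
    obtain ⟨y, hy⟩ := exists_pow_sub_exp_pow_eq_mul (u := T - 1)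
      ((norm_sub_le _ _).trans (by rw [norm_one]; linarith)) n
    rw [add_sub_cancel] at hy
    rw [hX, hy, sub_mul, one_mul, map_sub, sub_eq_zero]
    have h1 := (integralCLM (fun _ : Fin d → ℝ => (1 : ℝ)) (fun _ => abs_one.le)).hasSum
      (hTsum.mul_right y)
    refine h1.unique ?_
    have h2 := hf1.mul_right (integralCLM (fun _ : Fin d → ℝ => (1 : ℝ)) (fun _ => abs_one.le) y)
    rw [one_mul] at h2
    refine h2.congr_fun fun x => ?_
    rw [smul_mul_assoc, map_smul, integralCLM_one_shift_mul, smul_eq_mul]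
  refine ciSup_le fun ⟨A, hA⟩ => ?_
  have hu : Represents (F.toSignedMeasure - unitMass (Fin d → ℝ)) (T - 1) :=
    hT.sub represents_unitMass
  have hD := ((hu.smul (n : ℝ)).sub ((hu.convPow 2).smul ((n : ℝ) / 2))).expMeasure_apply hA
  have hexp : NormedSpace.exp ((n : ℝ) • (T - 1) - ((n : ℝ) / 2) • (T - 1) ^ 2) =
      NormedSpace.exp (T - 1 - (1 / 2 : ℝ) • (T - 1) ^ 2) ^ n := by
    rw [← exp_natCast_smul_real]
    congr 1
    module
  rw [hexp] at hD
  have hval : convPow F.toSignedMeasure n A - hippPow F n A =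
      integralCLM (A.indicator fun _ => 1) (abs_indicator_one_le A) X := by
    rw [hX, map_sub, (hT.convPow n).apply_eq hA, hippPow, hD]
  rw [hval]
  exact (abs_integralCLM_indicator_le (abs_indicator_one_le A) hX0).trans hmain

end Lattice

end SignedCP

/-! ### Conclusion -/

theorem theorem2 :
    ∃ C : ℝ, 0 < C ∧
      ∀ (d : ℕ) (F : Measure (Fin d → ℝ)) [IsProbabilityMeasure F],
        SignedCP.IsSymmetricLattice F →
        ∀ (q : ℝ), q = F.real {0} →
        ∀ (n : ℕ), 1 ≤ n →
          SignedCP.tvDist (SignedCP.convPow F.toSignedMeasure n) (SignedCP.hippPow F n) ≤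
            50.2 * SignedCP.delta F (n * q / 6) ^ 3 / (q ^ (7 / 2 : ℝ) * (n : ℝ) ^ 2) *
                (1 + C / (q ^ (7 / 2 : ℝ) * √(n : ℝ))) +
              C * (1 - q) ^ (15 / 2 : ℝ) / (q ^ 8 * (n : ℝ) ^ 2 * √(n : ℝ)) := by
  refine ⟨SignedCP.errConst, SignedCP.errConst_pos, fun d F _ hF q hq n hn => ?_⟩
  subst hq
  -- The first summand alone already bounds the distance; the last one is nonnegative and is simply
  -- added.
  refine (SignedCP.tvDist_convPow_hippPow_le hF hn).trans (le_add_of_nonneg_right ?_)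
  have h0 := hF.zero_pos
  have h1 : 0 ≤ 1 - F.real {0} := by linarith [hF.zero_lt_one]
  have hC := SignedCP.errConst_pos
  positivity
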